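/- Let $\Gamma$ be a simplicial graph with vertex set $I$, and for each $i\in I$ let $(W_i,S_i)$ be a Coxeter system with Coxeter matrix $m_i$ and let $(\mathcal B_i,\delta_i)$ be a building of type $(W_i,S_i)$. Put $S=\bigsqcup_i S_i$, and let $\widetilde W=\prod_\Gamma W_i$ be the Coxeter group with generating set $S$ and Coxeter matrix $\widetilde m(s,t)=m_i(s,t)$ for $s,t\in S_i$; $\widetilde m(s,t)=2$ for $s\in S_i$, $t\in S_j$ with $\{i,j\}$ an edge of $\Gamma$; and $\widetilde m(s,t)=\infty$ otherwise. Let $K'$ be the Davis chamber of $(\widetilde W,S)$ (the geometric realization of the poset of spherical subsets of $S$, whose $s$-mirror is the realization of the poset of spherical subsets containing $s$). Let $X$ be the $K'$-realization of the product building $\mathcal B=\prod_i\mathcal B_i$ (one copy of $K'$ for each chamber of $\mathcal B$, with the $s$-mirrors of $s$-adjacent chambers identified), and let $\widetilde X\to X$ be a universal covering. (It exists when $I$ is finite, the case in which $\prod_i W_i$ is a Coxeter group on the generating set $S$.) The graph product $\widetilde{\mathcal B}=\prod_\Gamma\mathcal B_i$ is the set of copies of $K'$ in $\widetilde X$, two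 of them being $s$-equivalent when they share their $s$-mirror; the covering induces $p:\widetilde{\mathcal B}\to\mathcal B$. Let $E_i$ be the set $\mathcal B_i$ with the rank-one metric (any two distinct chambers are adjacent, of the single type $i$), let $\widetilde E=\prod_\Gamma E_i$ be the right-angled building obtained by the same construction, and let $p_E:\widetilde E\to E=\prod_i E_i$ be its projection, with components $p_i:\widetilde E\to E_i$. As sets $E_i=\mathcal B_i$ and $E=\mathcal B$. $\mathrm{Aut}(\cdot)$ denotes the group of type-preserving automorphisms, i.e. of permutations of the chambers that map $s$-panels onto $s$-panels for every type $s$. For groups $G_i$ acting on $E_i$, let $\mathrm{SpAut}(\widetilde E)$ be the group of structure-preserving automorphisms of $\widetilde E$: those $g\in\mathrm{Aut}(\widetilde E)$ such that for every $i\in I$ and every $i$-panel $\mathcal R$ of $\widetilde E$ there is $g_i\in G_i$ with $p_i(g(C))=g_i\cdot p_i(C)$ for all $C\in\mathcal R$. Call a bijection $\phi:\widetilde E\to\widetilde{\mathcal B}$ an *identification* if $p\circ\phi=p_E$ and if, for every $i$, two chambers of $\widetilde E$ lie in the same $i$-panel exactly when their images lie in the same residue of type $S_i$ of $\widetilde{\mathcal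 B}$. Theorem. (1) An identification $\phi$ exists, and it is unique up to the choice of base chambers: for all $C_0\in\widetilde E$ and $C_1\in\widetilde{\mathcal B}$ with $p_E(C_0)=p(C_1)$ there is exactly one identification $\phi$ with $\phi(C_0)=C_1$. (2) Let $G_i=\mathrm{Aut}(\mathcal B_i)$ for every $i\in I$. Then for every identification $\phi$ the map $g\mapsto\phi\circ g\circ\phi^{-1}$ is a group isomorphism $\mathrm{SpAut}(\widetilde E)\to\mathrm{Aut}(\widetilde{\mathcal B})$. In particular $\mathrm{SpAut}(\widetilde E)\cong\mathrm{Aut}(\widetilde{\mathcal B})$. -/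

import Mathlib

open scoped Topology

namespace GraphBuilding

/-! ### Buildings -/

/-- `(X, δ)` is a building of type `(W, S)`: the axioms (WD1), (WD2), (WD3) of a Weyl distance. -/
structure IsBuilding {S W X : Type*} [Group W] {M : CoxeterMatrix S} (cs : CoxeterSystem M W)
    (δ : X → X → W) : Prop where
  nonempty : Nonempty X
  wd1 : ∀ C D, δ C D = 1 ↔ C = D
  wd2 : ∀ C D C' s, δ C' C = cs.simple s →
    (δ C' D = cs.simple s * δ C D ∨ δ C' D = δ C D) ∧
    (cs.length (cs.simple s * δ C D) = cs.length (δ C D) + 1 → δ C' D = cs.simple s * δ C D)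
  wd3 : ∀ C D s, ∃ C', δ C' C = cs.simple s ∧ δ C' D = cs.simple s * δ C D

/-- `s`-equivalence of chambers: being `s`-adjacent or equal. Its classes are the `s`-panels. -/
def sEquiv {S W X : Type*} [Group W] {M : CoxeterMatrix S} (cs : CoxeterSystem M W)
    (δ : X → X → W) (s : S) (C D : X) : Prop :=
  δ C D = cs.simple s ∨ C = D

/-- The group of type-preserving automorphisms: the permutations of the chambers that map
`s`-panels onto `s`-panels for every `s`, where `r s` is the relation of `s`-equivalence. -/
def typeAut {S X : Type*} (r : S → X → X → Prop) : Subgroup (Equiv.Perm X) where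
  carrier := {g | ∀ s C D, r s (g C) (g D) ↔ r s C D}
  one_mem' := fun _ _ _ => Iff.rfl
  mul_mem' := fun {a b} ha hb s C D => (ha s (b C) (b D)).trans (hb s C D)
  inv_mem' := fun {a} ha s C D => by
    have h := ha s (a⁻¹ C) (a⁻¹ D)
    simpa using h.symm

/-- `C` and `D` lie in the same residue of type `T`: they are joined by a gallery all of whose
adjacencies have types in `T`. -/
def SameResidue {S X : Type*} (r : S → X → X → Prop) (T : Set S) : X → X → Prop :=
  Relation.ReflTransGen fun C D => ∃ s ∈ T, r s C D

/-! ### Rank-one buildings -/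

/-- The Coxeter matrix with a single generator; its Coxeter group is `ℤ/2`. -/
def rankOneMatrix : CoxeterMatrix Unit where
  M := fun _ _ => 1
  isSymm := rfl
  diagonal := fun _ => rfl
  off_diagonal := fun _ _ h => absurd rfl h

/-- The Coxeter system of rank one, of type `ℤ/2`. -/
def rankOneSystem : CoxeterSystem rankOneMatrix rankOneMatrix.Group :=
  rankOneMatrix.toCoxeterSystem

open Classical in
/-- The rank-one metric on a set: any two distinct chambers are at distance the generator. -/
noncomputable def rankOneDist (X : Type*) (C D : X) : rankOneMatrix.Group :=
  if C = D then 1 else rankOneSystem.simple ()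

theorem simple_ne_one {S W : Type*} [Group W] {M : CoxeterMatrix S} (cs : CoxeterSystem M W)
    (s : S) : cs.simple s ≠ 1 := fun h => by
  have h1 := cs.length_simple s
  rw [h, cs.length_one] at h1
  exact absurd h1 (by norm_num)

/-- Any set with at least two elements is a building of type `ℤ/2` with the rank-one metric. -/
theorem isBuilding_rankOneDist (X : Type*) [Nontrivial X] :
    IsBuilding rankOneSystem (rankOneDist X) where
  nonempty := inferInstance
  wd1 := fun C D => by
    unfold rankOneDist
    split_ifs with h
    · simp [h]
    · simp [h, simple_ne_one]
  wd2 := fun C D C' s hs => by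
    have hne : C' ≠ C := by
      rintro rfl
      simp only [rankOneDist, if_true] at hs
      exact simple_ne_one _ _ hs.symm
    by_cases h1 : C = D
    · subst h1
      simp [rankOneDist, hne]
    · by_cases h2 : C' = D
      · subst h2
        simp [rankOneDist, h1]
      · simp [rankOneDist, h1, h2]
  wd3 := fun C D s => by
    by_cases h : C = D
    · subst h
      obtain ⟨C', hC'⟩ := exists_ne C
      exact ⟨C', by simp [rankOneDist, hC']⟩
    · exact ⟨D, by simp [rankOneDist, h, Ne.symm h]⟩

/-! ### The Davis chamber -/

/-- The geometric realization of a poset: barycentric coordinates supported on finite chains. -/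
def PosetRealization (P : Type*) [PartialOrder P] : Type _ :=
  {f : P → ℝ // (∀ a, 0 ≤ f a) ∧ f.support.Finite ∧ IsChain (· ≤ ·) f.support ∧ ∑ᶠ a, f a = 1}

/-- The weak topology: a set is open iff its intersection with each closed simplex, spanned by a
finite chain `c` and carrying the Euclidean topology, is open in that simplex. -/
instance (P : Type*) [PartialOrder P] : TopologicalSpace (PosetRealization P) :=
  ⨆ c : {c : Finset P // IsChain (· ≤ ·) (c : Set P)},
    TopologicalSpace.coinduced
      (Subtype.val : {f : PosetRealization P // f.1.support ⊆ c.1} → PosetRealization P)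
      (TopologicalSpace.induced (fun f => f.1.1) Pi.topologicalSpace)

/-- The poset of spherical subsets `T` of `S`, those that generate a finite subgroup of `W`,
ordered by inclusion. -/
abbrev SphericalPoset {S : Type*} (M : CoxeterMatrix S) : Type _ :=
  {T : Set S // (Subgroup.closure (M.simple '' T) : Set M.Group).Finite}

/-- The Davis chamber of the Coxeter system with matrix `M`. -/
abbrev DavisChamber {S : Type*} (M : CoxeterMatrix S) : Type _ :=
  PosetRealization (SphericalPoset M)

/-- The `s`-mirror of the Davis chamber: the realization of the poset of those spherical subsets
that contain `s`. -/
def mirror {S : Type*} (M : CoxeterMatrix S) (s : S) : Set (DavisChamber M) :=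
  {x | ∀ T ∈ x.1.support, s ∈ T.1}

/-! ### Realizations -/

/-- The `K`-realization of a set `X` of chambers with adjacency relations `adj s`, for a mirrored
space `K` with mirrors `mir s`: one copy of `K` for each chamber, where the `s`-mirrors of any two
`s`-adjacent chambers are identified pointwise. -/
def Realization {S X K : Type*} (adj : S → X → X → Prop) (mir : S → Set K) : Type _ :=
  Quot fun a b : (Σ _ : X, K) => a.2 = b.2 ∧ ∃ s, a.2 ∈ mir s ∧ adj s a.1 b.1

/-- The quotient topology, the set of chambers being discrete. -/
instance {S X K : Type*} [TopologicalSpace K] (adj : S → X → X → Prop) (mir : S → Set K) :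
    TopologicalSpace (Realization adj mir) :=
  inferInstanceAs (TopologicalSpace (Quot _))

/-- The point of the realization given by the point `x` in the copy of `K` for the chamber `C`. -/
def Realization.mk {S X K : Type*} (adj : S → X → X → Prop) (mir : S → Set K) (C : X) (x : K) :
    Realization adj mir :=
  Quot.mk _ ⟨C, x⟩

/-! ### Graph products -/

open Classical in
/-- The Coxeter matrix of the graph product of Coxeter groups over the graph `Γ`
(`0` encodes `∞`). -/
noncomputable def gpMatrix {I : Type*} (Γ : SimpleGraph I) {S : I → Type*}
    (M : ∀ i, CoxeterMatrix (S i)) : CoxeterMatrix (Σ i, S i) where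
  M := Matrix.of fun a b =>
    if h : a.1 = b.1 then M b.1 (h ▸ a.2) b.2 else if Γ.Adj a.1 b.1 then 2 else 0
  isSymm := Matrix.IsSymm.ext fun ⟨i, s⟩ ⟨j, t⟩ => by
    by_cases h : i = j
    · subst h
      simpa using (M i).symmetric t s
    · simp [h, Ne.symm h, Γ.adj_comm]
  diagonal := fun ⟨i, s⟩ => by simp
  off_diagonal := fun ⟨i, s⟩ ⟨j, t⟩ hne => by
    by_cases h : i = j
    · subst h
      have hst : s ≠ t := fun h => hne (by rw [h])
      simpa using (M i).off_diagonal s t hst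
    · by_cases h' : Γ.Adj i j <;> simp [h, h']

section

variable {I : Type*} (Γ : SimpleGraph I) {S W B : I → Type*} [∀ i, Group (W i)]
  {M : ∀ i, CoxeterMatrix (S i)} (cs : ∀ i, CoxeterSystem (M i) (W i)) (δ : ∀ i, B i → B i → W i)

open Classical in
/-- `s`-adjacency in the product `∏ B i`, whose distance takes values in `∏ W i` and is the product
of the distances `δ i`. The generators of `∏ W i` are those of the factors. -/
def prodAdj (s : Σ i, S i) (C D : ∀ i, B i) : Prop :=
  (fun i => δ i (C i) (D i)) = (Pi.mulSingle s.1 ((cs s.1).simple s.2) : ∀ i, W i)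

/-- The realization of the product building `∏ B i` by the Davis chamber of the graph product of
the Coxeter groups `W i` over `Γ`. -/
abbrev GPRealization : Type _ :=
  Realization (prodAdj cs δ) (mirror (gpMatrix Γ M))

end

/-- `q : Y → X` is a universal covering: `Y` is simply connected and `q` is a (surjective)
covering map. -/
structure IsUniversalCovering {X Y : Type*} [TopologicalSpace X] [TopologicalSpace Y]
    (q : Y → X) : Prop where
  simplyConnected : SimplyConnectedSpace Y
  isCoveringMap : IsCoveringMap q
  surjective : Function.Surjective q

section

variable {I : Type*} {Γ : SimpleGraph I} {S W B : I → Type*} [∀ i, Group (W i)]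
  {M : ∀ i, CoxeterMatrix (S i)} {cs : ∀ i, CoxeterSystem (M i) (W i)} {δ : ∀ i, B i → B i → W i}
  {Y : Type*} [TopologicalSpace Y]

/-- The chambers of the graph product of the buildings `B i` over `Γ`: the copies of the Davis
chamber in the universal cover `Y` of `GPRealization Γ cs δ`, that is, the lifts to `Y` of the
copies of the Davis chamber in `GPRealization Γ cs δ`. The field `base` is the image of the chamber
under the projection `p` to the product `∏ B i`. -/
@[ext]
structure GraphProduct (q : Y → GPRealization Γ cs δ) where
  base : ∀ i, B i
  lift : C(DavisChamber (gpMatrix Γ M), Y)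
  comm : ∀ x, q (lift x) = Realization.mk _ _ base x

/-- `s`-equivalence in the graph product: the two copies of the Davis chamber share their
`s`-mirror. -/
def GraphProduct.sEquiv (q : Y → GPRealization Γ cs δ) (s : Σ i, S i) (C D : GraphProduct q) :
    Prop :=
  ∀ x ∈ mirror (gpMatrix Γ M) s, C.lift x = D.lift x

/-- The relation of lying in the same residue of type `S i` in the graph product. -/
def GraphProduct.SameResidueAt (q : Y → GPRealization Γ cs δ) (i : I) (C D : GraphProduct q) :
    Prop :=
  SameResidue (GraphProduct.sEquiv q) {s | s.1 = i} C D

/-- `Aut` of the graph product, its group of type-preserving automorphisms. -/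
abbrev GraphProduct.aut (q : Y → GPRealization Γ cs δ) : Subgroup (Equiv.Perm (GraphProduct q)) :=
  typeAut (GraphProduct.sEquiv q)

end

section

variable {I : Type*} {Γ : SimpleGraph I}

/-- The realization whose universal cover defines the graph product over `Γ` of the rank-one
buildings with chamber sets `E i`. -/
abbrev RankOneGPRealization (Γ : SimpleGraph I) (E : I → Type*) : Type _ :=
  GPRealization Γ (fun _ => rankOneSystem) (fun i => rankOneDist (E i))

/-- The group of structure-preserving automorphisms of the right-angled building `Ẽ`, the graph
product of the rank-one buildings `E i`, with respect to actions of groups `G i` on the sets `E i`: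
on every `i`-panel (here the one containing `C`) the automorphism `g` is given, after projecting to
`E i`, by an element of `G i`. -/
def spAut {E : I → Type*} {Y : Type*} [TopologicalSpace Y] (q : Y → RankOneGPRealization Γ E)
    (G : I → Type*) [∀ i, Group (G i)] [∀ i, MulAction (G i) (E i)] :
    Subgroup (Equiv.Perm (GraphProduct q)) where
  carrier := {g | g ∈ GraphProduct.aut q ∧ ∀ (i : I) (C : GraphProduct q), ∃ a : G i,
    ∀ D, GraphProduct.sEquiv q ⟨i, ()⟩ C D → (g D).base i = a • D.base i}
  one_mem' := ⟨one_mem _, fun i C => ⟨1, fun D _ => by simp⟩⟩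
  mul_mem' := fun {g h} hg hh => ⟨mul_mem hg.1 hh.1, fun i C => by
    obtain ⟨b, hb⟩ := hh.2 i C
    obtain ⟨a, ha⟩ := hg.2 i (h C)
    refine ⟨a * b, fun D hD => ?_⟩
    rw [Equiv.Perm.mul_apply, ha (h D) ((hh.1 _ C D).2 hD), hb D hD, mul_smul]⟩
  inv_mem' := fun {g} hg => ⟨inv_mem hg.1, fun i C => by
    obtain ⟨a, ha⟩ := hg.2 i (g⁻¹ C)
    refine ⟨a⁻¹, fun D hD => ?_⟩
    have h := ha (g⁻¹ D) (((inv_mem hg.1) _ C D).2 hD)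
    have h' : g (g⁻¹ D) = D := g.apply_symm_apply D
    rw [h'] at h
    rw [h, inv_smul_smul]⟩

variable {S W B : I → Type*} [∀ i, Group (W i)] {M : ∀ i, CoxeterMatrix (S i)}
  {cs : ∀ i, CoxeterSystem (M i) (W i)} {δ : ∀ i, B i → B i → W i}
  {YE Y : Type*} [TopologicalSpace YE] [TopologicalSpace Y]

/-- The identification `φ : Ẽ → B̃` of the underlying right-angled building with the graph product:
a bijection of the chambers that commutes with the projections to `∏ E i = ∏ B i` and under which
the `i`-panels of `Ẽ` correspond to the residues of type `S i` of the graph product. -/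
structure IsUnderlyingIso (qE : YE → RankOneGPRealization Γ B) (q : Y → GPRealization Γ cs δ)
    (φ : GraphProduct qE ≃ GraphProduct q) : Prop where
  proj : ∀ C, (φ C).base = C.base
  panel : ∀ i C D, GraphProduct.sEquiv qE ⟨i, ()⟩ C D ↔
    GraphProduct.SameResidueAt q i (φ C) (φ D)

end

end GraphBuilding

open GraphBuilding

/-! Both `Ẽ` and `B̃` are universal among combinatorial coverings, so each maps to the other as soon
as it is seen as a covering of the right chamber system. A covering of chamber systems
(`IsChamberCover`) is bijective on panels and injective on spherical residues. Such a map induces a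
topological covering of Davis realizations (`isCoveringMap_realizationMap`), because the open star
of a spherical residue is evenly covered. Lifting the universal covering through it gives the
universal property `GraphProduct.exists_map`. Connectedness of the graph product makes the resulting
map unique once one value is prescribed (`GraphProduct.map_ext`).

For `Ẽ → B̃`, the residues of type `S i` of `B̃` are taken as `i`-panels
(`isChamberCover_residues`). The point is that such a residue projects bijectively onto `B i`. It is
a connected covering of `B i`, and buildings are simply connected (`IsBuildingCover.injective`): the
end of a lifted minimal gallery depends only on its end chamber below. This comes down to rank two,
through the exchange condition and gates of residues. Residues of adjacent factors commute, and
spherical subsets on the rank-one side are finite cliques of `Γ`, which gives injectivity on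
spherical residues.

For `B̃ → Ẽ`, the panels of `Ẽ` are refined by the `s`-panels of the factors
(`isChamberCover_refined`). A spherical subset of `S` meets only a finite clique of factors, so it
lies over a spherical subset of the rank-one graph product. The two composites are the identity by
uniqueness.

Part (2) rests on `GraphProduct.sEquiv_iff`: two chambers of `B̃` are `s`-equivalent exactly when
they share an `S i`-residue and their `i`-th projections are `s`-equivalent. Preserving all these
relations thus amounts to preserving the `i`-panels of `Ẽ` and acting on each of them through `Aut(B
i)`. -/

/-! ### The exchange condition and parabolic subgroups -/

namespace CoxeterSystem

variable {S W : Type*} [Group W] {M : CoxeterMatrix S} (cs : CoxeterSystem M W)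

open Classical in
/-- The involution of `W × ZMod 2` that conjugates by a simple reflection and changes the sign of
that reflection. -/
noncomputable def signFlip (s : S) (x : W × ZMod 2) : W × ZMod 2 :=
  (cs.simple s * x.1 * cs.simple s, x.2 + if x.1 = cs.simple s then 1 else 0)

-- Pulled back to the starting point, the reflections tested along the iteration are `t`, `tst`,
-- `tstst`, ..., that is `(ts)^r t` for `r < 2k`. The sign flips once for each of them that equals
-- `x.1`.
open Classical in
theorem signFlip_signFlip_iterate (s t : S) (k : ℕ) (x : W × ZMod 2) :
    (fun x => cs.signFlip s (cs.signFlip t x))^[k] x =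
      ((cs.simple s * cs.simple t) ^ k * x.1 * (cs.simple t * cs.simple s) ^ k,
        x.2 + ∑ r ∈ Finset.range (2 * k),
          if x.1 = (cs.simple t * cs.simple s) ^ r * cs.simple t then 1 else 0) := by
  induction k with
  | zero => simp
  | succ k ih =>
    rw [Function.iterate_succ_apply', ih]
    set a := cs.simple s
    set b := cs.simple t
    have ha : a⁻¹ = a := cs.inv_simple s
    have hb : b⁻¹ = b := cs.inv_simple t
    have hab : (a * b) ^ k = ((b * a) ^ k)⁻¹ := by
      rw [← inv_pow, mul_inv_rev, ha, hb]
    have hcomm : ∀ n : ℕ, (b * a) ^ n * b = b * ((b * a) ^ n)⁻¹ := fun n => by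
      induction n with
      | zero => simp
      | succ n ihn =>
        rw [pow_succ', mul_assoc, ihn, ← pow_succ', pow_succ, mul_inv_rev, mul_inv_rev, ha, hb]
        simp only [mul_assoc]
    have hc : ∀ g x y : W, g⁻¹ * x * g = y ↔ x = g * y * g⁻¹ := by
      intro g x y
      constructor
      · rintro rfl; group
      · rintro rfl; group
    have h1 : ((a * b) ^ k * x.1 * (b * a) ^ k = b) ↔ x.1 = (b * a) ^ (2 * k) * b := by
      rw [two_mul, pow_add, mul_assoc (_ ^ k) (_ ^ k) b, hcomm, hab, hc, mul_assoc]
    have h2 : (b * ((a * b) ^ k * x.1 * (b * a) ^ k) * b = a) ↔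
        x.1 = (b * a) ^ (2 * k + 1) * b := by
      have e : (b * a) ^ (2 * k + 1) * b = (b * a) ^ k * (b * a * b) * ((b * a) ^ k)⁻¹ := by
        rw [show 2 * k + 1 = k + 1 + k by ring, pow_add, mul_assoc, hcomm, pow_succ]
        simp only [mul_assoc]
      have hb' := hc b ((a * b) ^ k * x.1 * (b * a) ^ k) a
      rw [hb] at hb'
      rw [hb', hab, hc, e]
    rw [show 2 * (k + 1) = 2 * k + 1 + 1 by ring, Finset.sum_range_succ, Finset.sum_range_succ]
    simp only [signFlip]
    refine Prod.ext ?_ ?_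
    · simp only [a, b]
      rw [pow_succ', pow_succ (cs.simple t * cs.simple s)]
      simp only [mul_assoc]
    · change _ + (if (a * b) ^ k * x.1 * (b * a) ^ k = b then 1 else 0) +
        (if b * ((a * b) ^ k * x.1 * (b * a) ^ k) * b = a then 1 else 0) = _
      rw [if_congr h1 rfl rfl, if_congr h2 rfl rfl, add_assoc, add_assoc, add_assoc]

theorem signFlip_involutive (s : S) : Function.Involutive (cs.signFlip s) := fun x => by
  classical
  have h : cs.simple s * x.1 * cs.simple s = cs.simple s ↔ x.1 = cs.simple s := by
    rw [mul_eq_right, ← cs.inv_simple s, inv_mul_eq_one, eq_comm, cs.inv_simple]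
  refine Prod.ext ?_ ?_
  · simp [signFlip, mul_assoc]
  · change x.2 + _ + (if cs.simple s * x.1 * cs.simple s = cs.simple s then 1 else 0) = x.2
    rw [if_congr h rfl rfl, add_assoc, ← two_mul, show (2 : ZMod 2) = 0 from rfl, zero_mul, add_zero]

/-- Since `(ts)^m = 1`, the list of `2m` reflections is one list of length `m` repeated twice. Every
reflection is counted an even number of times and the signs cancel. -/
theorem isLiftable_signFlip :
    M.IsLiftable fun s => (cs.signFlip_involutive s).toPerm := by
  classical
  intro s t
  refine Equiv.ext fun x => ?_
  rw [← Equiv.Perm.iterate_eq_pow]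
  refine (cs.signFlip_signFlip_iterate s t _ x).trans ?_
  have h0 : (cs.simple t * cs.simple s) ^ M s t = 1 := cs.simple_mul_simple_pow' s t
  have h0' : (cs.simple s * cs.simple t) ^ M s t = 1 := cs.simple_mul_simple_pow s t
  rw [h0, h0', two_mul, Finset.sum_range_add]
  simp only [pow_add, h0, one_mul, mul_one]
  rw [← two_mul, show (2 : ZMod 2) = 0 from rfl, zero_mul, add_zero]
  rfl

/-- The action of the Coxeter group on `W × ZMod 2` that records inversions. -/
noncomputable def signRep : W →* Equiv.Perm (W × ZMod 2) :=
  cs.lift ⟨_, cs.isLiftable_signFlip⟩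

theorem signRep_simple (s : S) (x : W × ZMod 2) :
    cs.signRep (cs.simple s) x = cs.signFlip s x :=
  congrArg (· x) (cs.lift_apply_simple cs.isLiftable_signFlip s)

-- The left side depends only on the group element, so the parity with which `t` occurs in the right
-- inversion sequence does not depend on the word chosen. This is what the exchange condition needs.
open Classical in
theorem signRep_wordProd (ω : List S) (t : W) (ε : ZMod 2) :
    cs.signRep (cs.wordProd ω) (t, ε) =
      (cs.wordProd ω * t * (cs.wordProd ω)⁻¹, ε + ((cs.rightInvSeq ω).count t : ℕ)) := by
  induction ω with
  | nil => simp
  | cons i ω ih =>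
    rw [cs.wordProd_cons, map_mul, Equiv.Perm.mul_apply, ih, signRep_simple, signFlip]
    have h : cs.wordProd ω * t * (cs.wordProd ω)⁻¹ = cs.simple i ↔
        (cs.wordProd ω)⁻¹ * cs.simple i * cs.wordProd ω = t := by
      constructor
      · intro h; rw [← h]; group
      · intro h; rw [← h]; group
    refine Prod.ext ?_ ?_
    · simp [mul_assoc]
    · simp only [h, rightInvSeq, List.count_cons, beq_iff_eq]
      push_cast
      ring

/-- The exchange condition. -/
theorem exists_eraseIdx_of_isLeftDescent {ω : List S} {s : S}
    (h : cs.IsLeftDescent (cs.wordProd ω) s) :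
    ∃ j < ω.length, cs.simple s * cs.wordProd ω = cs.wordProd (ω.eraseIdx j) := by
  classical
  by_cases hs : cs.simple s ∈ cs.leftInvSeq ω
  · obtain ⟨j, hj, hjs⟩ := List.mem_iff_getElem.1 hs
    refine ⟨j, by simpa using hj, ?_⟩
    rw [← cs.getD_leftInvSeq_mul_wordProd ω j, List.getD_eq_getElem _ _ hj, hjs]
  · exfalso
    obtain ⟨ω', hω', hw⟩ := cs.exists_isReduced (cs.simple s * cs.wordProd ω)
    -- If `s` does not occur among the left inversions of `ω`, its parity is even for `w = wordProd
    -- ω`, hence odd for `sw`. Then `s` is an inversion of a reduced word of `sw`, which makes `w`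
    -- shorter than `sw`, against the descent.
    have h1 : cs.signRep ((cs.wordProd ω)⁻¹) (cs.simple s, 1) =
        ((cs.wordProd ω)⁻¹ * cs.simple s * ((cs.wordProd ω)⁻¹)⁻¹, 1) := by
      rw [← cs.wordProd_reverse, signRep_wordProd, rightInvSeq_reverse, List.count_reverse,
        List.count_eq_zero.2 hs]
      simp
    have h2 : (cs.signRep ((cs.simple s * cs.wordProd ω)⁻¹) (cs.simple s, 0)).2 = 1 := by
      rw [mul_inv_rev, cs.inv_simple, map_mul, Equiv.Perm.mul_apply, signRep_simple, signFlip]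
      simp only [cs.simple_mul_simple_cancel_right, if_true, zero_add, h1]
    rw [hw, ← cs.wordProd_reverse, signRep_wordProd, rightInvSeq_reverse, List.count_reverse] at h2
    have h3 : cs.simple s ∈ cs.leftInvSeq ω' := by
      by_contra h3
      rw [List.count_eq_zero.2 h3] at h2
      simp at h2
    have h4 := (cs.isLeftInversion_of_mem_leftInvSeq hω' h3).2
    rw [← hw, cs.simple_mul_simple_cancel_left] at h4
    exact absurd h (not_lt.2 h4.le)

/-- Induction on the word by the exchange condition. When a letter of `J` shortens the product, the
deleted letter lies in the `J`-part, since a deletion in a reduced word of `w₀` would contradict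
minimality in the coset. -/
theorem exists_word_length_add {J : Set S} {w₀ : W}
    (hmin : ∀ ω : List S, (∀ i ∈ ω, i ∈ J) → cs.length w₀ ≤ cs.length (cs.wordProd ω * w₀))
    (ω : List S) (hω : ∀ i ∈ ω, i ∈ J) :
    ∃ ω' : List S, (∀ i ∈ ω', i ∈ J) ∧ cs.wordProd ω' = cs.wordProd ω ∧
      cs.length (cs.wordProd ω * w₀) = ω'.length + cs.length w₀ := by
  induction ω with
  | nil => exact ⟨[], by simp, rfl, by simp⟩
  | cons i ω ih =>
    obtain ⟨ω', hJ, hp, hl⟩ := ih fun j hj => hω j (List.mem_cons_of_mem _ hj)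
    have hi : i ∈ J := hω i (by simp)
    rw [cs.wordProd_cons, ← hp, mul_assoc]
    rw [← hp] at hl
    rcases cs.length_simple_mul (cs.wordProd ω' * w₀) i with h | h
    · refine ⟨i :: ω', ?_, cs.wordProd_cons i ω', ?_⟩
      · simpa using ⟨hi, hJ⟩
      · rw [h, hl, List.length_cons]; ring
    · obtain ⟨ω₀, hr, rfl⟩ := cs.exists_isReduced w₀
      rw [← cs.wordProd_append] at h
      have hd : cs.IsLeftDescent (cs.wordProd (ω' ++ ω₀)) i := cs.isLeftDescent_iff.2 h
      obtain ⟨j, hj, he⟩ := cs.exists_eraseIdx_of_isLeftDescent hd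
      by_cases hjl : j < ω'.length
      · rw [List.eraseIdx_append_of_lt_length hjl, cs.wordProd_append, cs.wordProd_append,
          ← mul_assoc, mul_left_inj] at he
        refine ⟨ω'.eraseIdx j, fun k hk => hJ k (List.mem_of_mem_eraseIdx hk), he.symm, ?_⟩
        rw [cs.wordProd_append] at h
        have := List.length_eraseIdx_add_one hjl
        omega
      · rw [not_lt] at hjl
        rw [List.eraseIdx_append_of_length_le hjl, cs.wordProd_append, cs.wordProd_append] at he
        exfalso
        -- The shortened `w₀` equals `x⁻¹ i x w₀` with `x = wordProd ω'`, so it still lies in the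
        -- coset of `w₀`.
        have h1 : cs.wordProd (ω₀.eraseIdx (j - ω'.length)) =
            cs.wordProd (ω'.reverse ++ i :: ω') * cs.wordProd ω₀ := by
          rw [cs.wordProd_append, cs.wordProd_reverse, cs.wordProd_cons]
          simp only [mul_assoc]
          rw [he]; simp
        have h2 := hmin (ω'.reverse ++ i :: ω') (by
          intro k hk
          simp only [List.mem_append, List.mem_reverse, List.mem_cons] at hk
          rcases hk with hk | rfl | hk
          exacts [hJ k hk, hi, hJ k hk])
        rw [← h1, hr.eq] at h2
        have h3 := cs.length_wordProd_le (ω₀.eraseIdx (j - ω'.length))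
        have h4 : j - ω'.length < ω₀.length := by
          rw [List.length_append] at hj; omega
        have := List.length_eraseIdx_add_one h4
        omega

theorem exists_word_length {J : Set S} (ω : List S) (hω : ∀ i ∈ ω, i ∈ J) :
    ∃ ω' : List S, (∀ i ∈ ω', i ∈ J) ∧ cs.wordProd ω' = cs.wordProd ω ∧
      cs.length (cs.wordProd ω) = ω'.length := by
  simpa using cs.exists_word_length_add (w₀ := 1) (by simp) ω hω

theorem length_wordProd_mul {J : Set S} {w₀ : W}
    (hmin : ∀ ω : List S, (∀ i ∈ ω, i ∈ J) → cs.length w₀ ≤ cs.length (cs.wordProd ω * w₀))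
    (ω : List S) (hω : ∀ i ∈ ω, i ∈ J) :
    cs.length (cs.wordProd ω * w₀) = cs.length (cs.wordProd ω) + cs.length w₀ := by
  obtain ⟨ω', -, h2, h3⟩ := cs.exists_word_length_add hmin ω hω
  refine le_antisymm (cs.length_mul_le _ _) ?_
  rw [h3, ← h2]
  exact Nat.add_le_add_right (cs.length_wordProd_le ω') _

theorem exists_isLeftDescent_mem {J : Set S} (ω : List S) (hω : ∀ i ∈ ω, i ∈ J)
    (h : cs.wordProd ω ≠ 1) : ∃ i ∈ J, ∃ ω' : List S, (∀ i ∈ ω', i ∈ J) ∧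
      cs.wordProd ω = cs.simple i * cs.wordProd ω' ∧
      cs.length (cs.wordProd ω) = cs.length (cs.wordProd ω') + 1 := by
  obtain ⟨ω', h1, h2, h3⟩ := cs.exists_word_length ω hω
  match ω', h1, h2, h3 with
  | [], _, h2, _ => exact absurd (by simpa using h2.symm) h
  | i :: ω', h1, h2, h3 =>
    rw [cs.wordProd_cons] at h2
    refine ⟨i, h1 i (by simp), ω', fun k hk => h1 k (by simp [hk]), h2.symm, ?_⟩
    have h4 := cs.length_wordProd_le ω'
    rw [List.length_cons] at h3
    have h5 := cs.length_simple_mul (cs.wordProd ω') i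
    rw [h2] at h5
    omega

theorem exists_minimal_coset (J : Set S) (w : W) :
    ∃ (ω : List S) (w₀ : W), (∀ i ∈ ω, i ∈ J) ∧ w = cs.wordProd ω * w₀ ∧
      ∀ ω : List S, (∀ i ∈ ω, i ∈ J) → cs.length w₀ ≤ cs.length (cs.wordProd ω * w₀) := by
  let P : Set W := {x | ∃ ω : List S, (∀ i ∈ ω, i ∈ J) ∧ x = cs.wordProd ω * w}
  have hP : P.Nonempty := ⟨w, [], by simp, by simp⟩
  obtain ⟨w₀, ⟨ω, hω, hw⟩, hmin⟩ : ∃ w₀ ∈ P, ∀ x ∈ P, cs.length w₀ ≤ cs.length x :=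
    ⟨_, Function.argminOn_mem cs.length P hP, fun x hx => Function.argminOn_le cs.length P hx⟩
  refine ⟨ω.reverse, w₀, by simpa using hω, by rw [hw]; simp, fun ω' hω' => ?_⟩
  refine hmin _ ⟨ω' ++ ω, ?_, ?_⟩
  · intro i hi
    rcases List.mem_append.1 hi with hi | hi
    exacts [hω' i hi, hω i hi]
  · rw [cs.wordProd_append, mul_assoc, ← hw]

/-- The alternating product of `n` factors that starts with `s`. -/
def altProd (s t : S) : ℕ → W
  | 0 => 1
  | n + 1 => cs.simple s * altProd t s n

theorem altProd_mul_inv (s t : S) (n : ℕ) :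
    cs.altProd s t n * (cs.altProd t s n)⁻¹ = (cs.simple s * cs.simple t) ^ n := by
  induction n generalizing s t with
  | zero => simp [altProd]
  | succ n ih =>
    simp only [altProd, mul_inv_rev, cs.inv_simple]
    calc _ = cs.simple s * (cs.altProd t s n * (cs.altProd s t n)⁻¹) * cs.simple t := by
          simp only [mul_assoc]
      _ = _ := by
          rw [ih, pow_succ', mul_assoc, mul_assoc]
          congr 1
          clear ih
          induction n with
          | zero => simp
          | succ n ih =>
            rw [pow_succ', pow_succ', mul_assoc, ih]
            simp only [mul_assoc]

/-- Once the descent `s` is removed, `s` is no longer a descent of the remainder. As the remainder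
lies in the subgroup generated by `s` and `t`, it is trivial or has the descent `t`, and the roles
alternate. -/
theorem eq_altProd {s t : S} (n : ℕ) (ω : List S)
    (hω : ∀ i ∈ ω, i ∈ ({s, t} : Set S)) (hn : cs.length (cs.wordProd ω) = n)
    (hd : n = 0 ∨ cs.IsLeftDescent (cs.wordProd ω) s) : cs.wordProd ω = cs.altProd s t n := by
  induction n generalizing s t ω with
  | zero => exact cs.length_eq_zero_iff.1 hn
  | succ n ih =>
    have hd := hd.resolve_left (by simp)
    have h1 := cs.isLeftDescent_iff.1 hd
    have h2 : cs.wordProd (s :: ω) = cs.simple s * cs.wordProd ω := cs.wordProd_cons s ω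
    rw [← h2] at h1
    have hω' : ∀ i ∈ s :: ω, i ∈ ({t, s} : Set S) := by
      intro i hi
      rcases List.mem_cons.1 hi with rfl | hi
      · simp
      · rw [Set.pair_comm]; exact hω i hi
    have h3 : cs.wordProd (s :: ω) = cs.altProd t s n := by
      refine ih (s :: ω) hω' (by omega) ?_
      rcases Nat.eq_zero_or_pos n with h | h
      · exact Or.inl h
      · right
        obtain ⟨i, hi, ω', -, h5, h6⟩ := cs.exists_isLeftDescent_mem (s :: ω) hω' (fun h7 => by
          rw [h7, cs.length_one] at h1; omega)
        rcases hi with rfl | hi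
        · rw [IsLeftDescent, h5, cs.simple_mul_simple_cancel_left, ← h5]; omega
        · rw [Set.mem_singleton_iff] at hi
          subst hi
          rw [h2, mul_right_inj] at h5
          rw [h2, h5] at h1
          rw [h2, h5] at h6
          omega
    rw [altProd, ← h3, h2, cs.simple_mul_simple_cancel_left]

/-- Two simple reflections that are both left descents of some element generate a finite group. -/
theorem exists_pow_eq_one_of_isLeftDescent {s t : S} {w : W} (hs : cs.IsLeftDescent w s)
    (ht : cs.IsLeftDescent w t) : ∃ k ≠ 0, (cs.simple s * cs.simple t) ^ k = 1 := by
  obtain ⟨ω, w₀, hω, rfl, hmin⟩ := cs.exists_minimal_coset {s, t} w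
  have key : ∀ i ∈ ({s, t} : Set S), cs.IsLeftDescent (cs.wordProd ω * w₀) i →
      cs.IsLeftDescent (cs.wordProd ω) i := by
    intro i hi h
    have h1 := cs.length_wordProd_mul hmin ω hω
    have h2 := cs.length_wordProd_mul hmin (i :: ω) (by
      intro j hj
      rcases List.mem_cons.1 hj with rfl | hj
      exacts [hi, hω j hj])
    rw [IsLeftDescent, h1, ← mul_assoc, ← cs.wordProd_cons, h2] at h
    rw [IsLeftDescent, ← cs.wordProd_cons]
    omega
  have hs' := key s (by simp) hs
  have ht' := key t (by simp) ht
  -- Lengths add over the minimal coset decomposition, so `s` and `t` are descents of the dihedral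
  -- part. It is therefore the alternating product of its length from either letter, and comparing
  -- the two gives `(st)^n = 1`.
  have h1 := cs.eq_altProd _ ω hω rfl (Or.inr hs')
  have h2 := cs.eq_altProd (s := t) (t := s) _ ω (by rwa [Set.pair_comm]) rfl (Or.inr ht')
  refine ⟨cs.length (cs.wordProd ω), ?_, ?_⟩
  · have := cs.isLeftDescent_iff.1 hs'
    omega
  · rw [← altProd_mul_inv, ← h1, ← h2, mul_inv_cancel]

end CoxeterSystem

/-! ### Buildings and their coverings -/

namespace GraphBuilding

theorem SameResidue.single {S X : Type*} {r : S → X → X → Prop} {T : Set S} {s : S} (hs : s ∈ T)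
    {C D : X} (h : r s C D) : SameResidue r T C D :=
  Relation.ReflTransGen.single ⟨s, hs, h⟩

theorem SameResidue.refl {S X : Type*} {r : S → X → X → Prop} {T : Set S} (C : X) :
    SameResidue r T C C :=
  Relation.ReflTransGen.refl

theorem SameResidue.trans {S X : Type*} {r : S → X → X → Prop} {T : Set S} {C D E : X}
    (h : SameResidue r T C D) (h' : SameResidue r T D E) : SameResidue r T C E :=
  Relation.ReflTransGen.trans h h'

theorem SameResidue.symm {S X : Type*} {r : S → X → X → Prop} (hr : ∀ s C D, r s C D → r s D C)
    {T : Set S} {C D : X} (h : SameResidue r T C D) : SameResidue r T D C := by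
  induction h with
  | refl => exact .refl _
  | tail _ h ih =>
    obtain ⟨s, hs, h⟩ := h
    exact (SameResidue.single hs (hr s _ _ h)).trans ih

theorem SameResidue.mono {S X : Type*} {r : S → X → X → Prop} {T T' : Set S} (hT : T ⊆ T')
    {C D : X} (h : SameResidue r T C D) : SameResidue r T' C D :=
  Relation.ReflTransGen.mono (fun _ _ ⟨s, hs, h⟩ => ⟨s, hT hs, h⟩) _ _ h

theorem SameResidue.of_singleton {S X : Type*} {r : S → X → X → Prop} {s : S}
    (hr : ∀ C, r s C C) (ht : ∀ C D E, r s C D → r s D E → r s C E) {C D : X}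
    (h : SameResidue r {s} C D) : r s C D := by
  induction h with
  | refl => exact hr _
  | tail _ h ih =>
    obtain ⟨t, rfl, h⟩ := h
    exact ht _ _ _ ih h

theorem SameResidue.map {S X S' X' : Type*} {r : S → X → X → Prop} {r' : S' → X' → X' → Prop}
    {T : Set S} {T' : Set S'} (f : X → X')
    (hf : ∀ s ∈ T, ∀ C D, r s C D → SameResidue r' T' (f C) (f D)) {C D : X}
    (h : SameResidue r T C D) : SameResidue r' T' (f C) (f D) := by
  induction h with
  | refl => exact .refl _
  | tail _ h ih =>
    obtain ⟨s, hs, h⟩ := h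
    exact ih.trans (hf s hs _ _ h)

section

variable {S W B : Type*} [Group W] {M : CoxeterMatrix S} {cs : CoxeterSystem M W} {δ : B → B → W}

/-! ### Residues and gates of a building. -/

namespace IsBuilding

theorem dist_symm (hB : IsBuilding cs δ) {s : S} {C D : B} (h : δ C D = cs.simple s) :
    δ D C = cs.simple s := by
  rcases (hB.wd2 D C C s h).1 with h1 | h1
  · rw [(hB.wd1 C C).2 rfl, eq_comm, ← inv_eq_iff_mul_eq_one, cs.inv_simple] at h1
    exact h1.symm
  · rw [(hB.wd1 C C).2 rfl, eq_comm, hB.wd1] at h1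
    subst h1
    exact h

theorem sEquiv_equivalence (hB : IsBuilding cs δ) (s : S) : Equivalence (sEquiv cs δ s) where
  refl C := Or.inr rfl
  symm := by
    rintro C D (h | rfl)
    exacts [Or.inl (hB.dist_symm h), Or.inr rfl]
  trans := by
    rintro C D E (h | rfl) (h' | rfl)
    · rcases (hB.wd2 D E C s h).1 with h1 | h1
      · rw [h', cs.simple_mul_simple_self, hB.wd1] at h1
        exact Or.inr h1
      · exact Or.inl (h1.trans h')
    · exact Or.inl h
    · exact Or.inl h'
    · exact Or.inr rfl

theorem sameResidue_univ (hB : IsBuilding cs δ) (C D : B) :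
    SameResidue (sEquiv cs δ) Set.univ C D := by
  induction h : cs.length (δ C D) generalizing C with
  | zero =>
    rw [cs.length_eq_zero_iff, hB.wd1] at h
    exact h ▸ .refl _
  | succ n ih =>
    obtain ⟨s, hs⟩ := cs.exists_leftDescent_of_ne_one (w := δ C D) (by
      intro h1; simp [h1] at h)
    obtain ⟨C', h1, h2⟩ := hB.wd3 C D s
    refine (SameResidue.single (Set.mem_univ s) (Or.inl (hB.dist_symm h1))).trans (ih C' ?_)
    rw [h2]
    have := cs.isLeftDescent_iff.1 hs
    omega

theorem exists_word_of_sameResidue (hB : IsBuilding cs δ) {J : Set S} {C D : B}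
    (h : SameResidue (sEquiv cs δ) J C D) :
    ∃ ω : List S, (∀ i ∈ ω, i ∈ J) ∧ δ C D = cs.wordProd ω := by
  induction h using Relation.ReflTransGen.head_induction_on with
  | refl => exact ⟨[], by simp, by simpa using (hB.wd1 D D).2 rfl⟩
  | head h _ ih =>
    obtain ⟨ω, hω, h1⟩ := ih
    obtain ⟨s, hs, h | rfl⟩ := h
    · rcases (hB.wd2 _ D _ s h).1 with h2 | h2
      · exact ⟨s :: ω, by simpa using ⟨hs, hω⟩, by rw [h2, h1, cs.wordProd_cons]⟩
      · exact ⟨ω, hω, h2.trans h1⟩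
    · exact ⟨ω, hω, h1⟩

/-- Minimality makes `E` the gate of its `J`-residue as seen from `C`. Lengths add on moving away
from `E` inside the residue, so (WD2) leaves no choice for the distance at each step. -/
theorem dist_of_gate (hB : IsBuilding cs δ) {J : Set S} {C E : B}
    (hmin : ∀ ω : List S, (∀ i ∈ ω, i ∈ J) →
      cs.length (δ E C) ≤ cs.length (cs.wordProd ω * δ E C))
    (F : B) (ω : List S) (hω : ∀ i ∈ ω, i ∈ J) (hF : δ F E = cs.wordProd ω) :
    δ F C = cs.wordProd ω * δ E C := by
  induction h : cs.length (cs.wordProd ω) generalizing F ω with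
  | zero =>
    rw [cs.length_eq_zero_iff] at h
    rw [h, hB.wd1] at hF
    rw [hF, h, one_mul]
  | succ n ih =>
    obtain ⟨i, hi, ω', hω', h1, h2⟩ := cs.exists_isLeftDescent_mem ω hω (by
      intro h1; simp [h1] at h)
    obtain ⟨F', h3, h4⟩ := hB.wd3 F E i
    rw [hF, h1, cs.simple_mul_simple_cancel_left] at h4
    have h5 := ih F' ω' hω' h4 (by omega)
    rw [h1, mul_assoc, ← h5]
    refine (hB.wd2 F' C F i (hB.dist_symm h3)).2 ?_
    rw [h5, ← mul_assoc, ← h1, cs.length_wordProd_mul hmin ω hω,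
      cs.length_wordProd_mul hmin ω' hω', h2]
    ring

/-- The chamber of a residue nearest to a given chamber is unique. -/
theorem gate_unique (hB : IsBuilding cs δ) {J : Set S} {C E F : B}
    (hmin : ∀ ω : List S, (∀ i ∈ ω, i ∈ J) →
      cs.length (δ E C) ≤ cs.length (cs.wordProd ω * δ E C))
    (hr : SameResidue (sEquiv cs δ) J F E) (h : δ F C = δ E C) : F = E := by
  obtain ⟨ω, hω, hd⟩ := hB.exists_word_of_sameResidue hr
  have h1 := hB.dist_of_gate hmin F ω hω hd
  rw [h, right_eq_mul] at h1
  rwa [h1, hB.wd1] at hd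

end IsBuilding

/-- A chamber system `Z` of type `S` covers the building `B`: panels are mapped bijectively to
panels, and residues of rank two and finite type are mapped injectively. -/
structure IsBuildingCover {Z : Type*} (cs : CoxeterSystem M W) (δ : B → B → W)
    (r : S → Z → Z → Prop) (π : Z → B) : Prop where
  symm : ∀ s z z', r s z z' → r s z' z
  map : ∀ s z z', r s z z' → sEquiv cs δ s (π z) (π z')
  lift : ∀ s z b, sEquiv cs δ s (π z) b → ∃ z', π z' = b ∧ r s z z'
  inj : ∀ s t z z', (∃ k ≠ 0, (cs.simple s * cs.simple t) ^ k = 1) →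
    SameResidue r {s, t} z z' → π z = π z' → z = z'

/-- The end points of the lifts to `Z` of the minimal galleries that start at `π z₀`. -/
inductive IsMinLift {Z : Type*} (cs : CoxeterSystem M W) (δ : B → B → W)
    (r : S → Z → Z → Prop) (π : Z → B) (z₀ : Z) : Z → Prop
  | base : IsMinLift cs δ r π z₀ z₀
  | step {z z' : Z} {s : S} : IsMinLift cs δ r π z₀ z → r s z z' →
    δ (π z') (π z₀) = cs.simple s * δ (π z) (π z₀) →
    cs.length (δ (π z') (π z₀)) = cs.length (δ (π z) (π z₀)) + 1 →
    IsMinLift cs δ r π z₀ z'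

/-! ### Simple connectedness of buildings. -/

namespace IsBuildingCover

variable {Z : Type*} {r : S → Z → Z → Prop} {π : Z → B}

/-- The case `s = t`, `k = 1` of `inj` says that a panel injects; reflexivity follows from it, and
later lemmas use it the same way. -/
theorem rel_refl (hZ : IsBuildingCover cs δ r π) (s : S) (z : Z) : r s z z := by
  obtain ⟨y, hy, h⟩ := hZ.lift s z (π z) (Or.inr rfl)
  have : z = y := hZ.inj s s z y ⟨1, one_ne_zero, by simp⟩ (.single (by simp) h) hy.symm
  subst this
  exact h

theorem exists_isMinLift (hB : IsBuilding cs δ) (hZ : IsBuildingCover cs δ r π) (z₀ : Z) (D : B) :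
    ∃ z, IsMinLift cs δ r π z₀ z ∧ π z = D := by
  induction h : cs.length (δ D (π z₀)) generalizing D with
  | zero =>
    rw [cs.length_eq_zero_iff, hB.wd1] at h
    exact ⟨z₀, .base, h.symm⟩
  | succ n ih =>
    obtain ⟨s, hs⟩ := cs.exists_leftDescent_of_ne_one (w := δ D (π z₀)) (by
      intro h1; simp [h1] at h)
    obtain ⟨D', h1, h2⟩ := hB.wd3 D (π z₀) s
    have h3 := cs.isLeftDescent_iff.1 hs
    obtain ⟨z, hz, rfl⟩ := ih D' (by rw [h2]; omega)
    obtain ⟨z', rfl, hz'⟩ := hZ.lift s z D (Or.inl h1)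
    refine ⟨z', .step hz hz' ?_ ?_, rfl⟩
    · rw [h2, cs.simple_mul_simple_cancel_left]
    · rw [h2, h3]

/-- A lifted minimal gallery can be replaced by one that passes through a lift of the gate of the
`J`-residue. The hypothesis `hU` is the uniqueness already known below length `n`; it ensures that
the new gallery ends at `z` itself and not at another chamber over `π z`. -/
theorem exists_descent (hB : IsBuilding cs δ) (hZ : IsBuildingCover cs δ r π) {z₀ : Z} {n : ℕ}
    (hU : ∀ z z', IsMinLift cs δ r π z₀ z → IsMinLift cs δ r π z₀ z' → π z = π z' →
      cs.length (δ (π z) (π z₀)) < n → z = z')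
    {J : Set S} {w₀ : W} (hmin : ∀ ω : List S, (∀ i ∈ ω, i ∈ J) →
      cs.length w₀ ≤ cs.length (cs.wordProd ω * w₀))
    (z : Z) (hz : IsMinLift cs δ r π z₀ z) (ω : List S) (hω : ∀ i ∈ ω, i ∈ J)
    (hd : δ (π z) (π z₀) = cs.wordProd ω * w₀) (hn : cs.length (δ (π z) (π z₀)) < n) :
    ∃ y, IsMinLift cs δ r π z₀ y ∧ δ (π y) (π z₀) = w₀ ∧ SameResidue r J y z := by
  induction h : cs.length (cs.wordProd ω) generalizing z ω with
  | zero =>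
    rw [cs.length_eq_zero_iff] at h
    rw [h, one_mul] at hd
    exact ⟨z, hz, hd, .refl _⟩
  | succ m ih =>
    obtain ⟨i, hi, ω', hω', h1, h2⟩ := cs.exists_isLeftDescent_mem ω hω (by
      intro h1; simp [h1] at h)
    obtain ⟨D, h3, h4⟩ := hB.wd3 (π z) (π z₀) i
    rw [hd, h1, mul_assoc, cs.simple_mul_simple_cancel_left] at h4
    obtain ⟨y, hy, rfl⟩ := hZ.exists_isMinLift hB z₀ D
    have h5 : cs.length (δ (π z) (π z₀)) = cs.length (δ (π y) (π z₀)) + 1 := by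
      rw [hd, h4, cs.length_wordProd_mul hmin ω hω, cs.length_wordProd_mul hmin ω' hω', h2]
      ring
    obtain ⟨z', h6, h7⟩ := hZ.lift i y (π z) (Or.inl h3)
    have h8 : z' = z := by
      refine hU z' z (.step hy h7 ?_ ?_) hz h6 (h6 ▸ hn)
      · rw [h6, hd, h4, h1, mul_assoc]
      · rw [h6, h5]
    obtain ⟨x, hx, h9, h10⟩ := ih y hy ω' hω' h4 (by omega) (by omega)
    exact ⟨x, hx, h9, h10.trans (.single hi (h8 ▸ h7))⟩

/-- If the last steps have types `s` and `t`, both are descents of the distance, so `st` has finite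
order. Descending in the `{s, t}`-residue from the two penultimate chambers leads to lifts of the
same gate, equal by induction. Hence `z` and `z'` share a rank-two residue of finite type, on which
`π` is injective. -/
theorem isMinLift_unique (hB : IsBuilding cs δ) (hZ : IsBuildingCover cs δ r π) {z₀ : Z} (n : ℕ) :
    ∀ z z', IsMinLift cs δ r π z₀ z → IsMinLift cs δ r π z₀ z' → π z = π z' →
      cs.length (δ (π z) (π z₀)) < n → z = z' := by
  induction n with
  | zero => intro z z' _ _ _ h; exact absurd h (Nat.not_lt_zero _)
  | succ n ih =>
    intro z z' hz hz' he hn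
    have h0 : δ (π z₀) (π z₀) = 1 := (hB.wd1 _ _).2 rfl
    cases hz with
    | base =>
      cases hz' with
      | base => rfl
      | step h1 h2 h3 h4 => rw [← he, h0, cs.length_one] at h4; omega
    | @step z₁ _ s h1 h2 h3 h4 =>
      cases hz' with
      | base => rw [he, h0, cs.length_one] at h4; omega
      | @step z₂ _ t h1' h2' h3' h4' =>
        have hsd : cs.IsLeftDescent (δ (π z) (π z₀)) s := by
          rw [CoxeterSystem.IsLeftDescent, h3, cs.simple_mul_simple_cancel_left, ← h3]; omega
        have htd : cs.IsLeftDescent (δ (π z) (π z₀)) t := by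
          rw [he, CoxeterSystem.IsLeftDescent, h3', cs.simple_mul_simple_cancel_left, ← h3']
          omega
        obtain ⟨ω, w₀, hω, hw, hmin⟩ := cs.exists_minimal_coset {s, t} (δ (π z) (π z₀))
        obtain ⟨y₁, hy₁, hd₁, hr₁⟩ := hZ.exists_descent hB ih hmin z₁ h1 (s :: ω) (by
          intro i hi
          rcases List.mem_cons.1 hi with rfl | hi
          exacts [by simp, hω i hi]) (by
          rw [cs.wordProd_cons, mul_assoc, ← hw, h3, cs.simple_mul_simple_cancel_left]) (by omega)
        obtain ⟨y₂, hy₂, hd₂, hr₂⟩ := hZ.exists_descent hB ih hmin z₂ h1' (t :: ω) (by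
          intro i hi
          rcases List.mem_cons.1 hi with rfl | hi
          exacts [by simp, hω i hi]) (by
          rw [cs.wordProd_cons, mul_assoc, ← hw, he, h3', cs.simple_mul_simple_cancel_left]) (by
          rw [he] at hn; omega)
        have hr₁' := hr₁.trans (.single (by simp) h2)
        have hr₂' := hr₂.trans (.single (by simp) h2')
        have hmap : ∀ {a b}, SameResidue r {s, t} a b →
            SameResidue (sEquiv cs δ) {s, t} (π a) (π b) := fun h =>
          h.map π fun i hi C D h => .single hi (hZ.map i _ _ h)
        have hy : π y₁ = π y₂ := by
          refine hB.gate_unique (hd₂.symm ▸ hmin) ?_ (hd₁.trans hd₂.symm)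
          refine (hmap hr₁').trans (he ▸ (hmap hr₂').symm fun s _ _ h => ?_)
          exact (hB.sEquiv_equivalence s).symm h
        have hyy : y₁ = y₂ := by
          refine ih y₁ y₂ hy₁ hy₂ hy ?_
          have h5 := hmin (s :: ω) (by
            intro i hi
            rcases List.mem_cons.1 hi with rfl | hi
            exacts [by simp, hω i hi])
          rw [cs.wordProd_cons, mul_assoc, ← hw, h3, cs.simple_mul_simple_cancel_left] at h5
          rw [hd₁]
          omega
        subst hyy
        exact hZ.inj s t z z' (cs.exists_pow_eq_one_of_isLeftDescent hsd htd)
          ((hr₁'.symm hZ.symm).trans hr₂') he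

/-- The ends of lifted minimal galleries are closed under adjacency, hence fill a connected
component. Every chamber of a panel is the gate of the panel or one ascending step away from it. -/
theorem isMinLift_of_rel (hB : IsBuilding cs δ) (hZ : IsBuildingCover cs δ r π) {z₀ z z' : Z}
    {s : S} (hz : IsMinLift cs δ r π z₀ z) (h : r s z z') : IsMinLift cs δ r π z₀ z' := by
  have hU : ∀ z z', IsMinLift cs δ r π z₀ z → IsMinLift cs δ r π z₀ z' → π z = π z' → z = z' :=
    fun z z' h1 h2 h3 => hZ.isMinLift_unique hB _ z z' h1 h2 h3 (Nat.lt_succ_self _)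
  -- the chamber of the panel nearest to the base chamber
  obtain ⟨y, hy, hyz, hup⟩ : ∃ y, IsMinLift cs δ r π z₀ y ∧ r s y z ∧
      ¬ cs.IsLeftDescent (δ (π y) (π z₀)) s := by
    by_cases hd : cs.IsLeftDescent (δ (π z) (π z₀)) s
    · obtain ⟨D, h1, h2⟩ := hB.wd3 (π z) (π z₀) s
      obtain ⟨y, hy, rfl⟩ := hZ.exists_isMinLift hB z₀ D
      obtain ⟨x, hx, hyx⟩ := hZ.lift s y (π z) (Or.inl h1)
      have h3 := cs.isLeftDescent_iff.1 hd
      have hxm : IsMinLift cs δ r π z₀ x := by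
        refine .step hy hyx ?_ ?_
        · rw [hx, h2, cs.simple_mul_simple_cancel_left]
        · rw [hx, h2, h3]
      refine ⟨y, hy, hU x z hxm hz hx ▸ hyx, ?_⟩
      rw [CoxeterSystem.IsLeftDescent, h2, cs.simple_mul_simple_cancel_left]
      omega
    · exact ⟨z, hz, hZ.rel_refl s z, hd⟩
  obtain ⟨x, hx, hyx⟩ := hZ.lift s y (π z') (by
    exact (hB.sEquiv_equivalence s).trans (hZ.map _ _ _ hyz) (hZ.map _ _ _ h))
  have hxz : x = z' := hZ.inj s s x z' ⟨1, one_ne_zero, by simp⟩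
    (((SameResidue.single (by simp) hyx).symm hZ.symm).trans
      ((SameResidue.single (by simp) hyz).trans (.single (by simp) h))) hx
  subst hxz
  rcases hZ.map _ _ _ hyx with h1 | h1
  · have h2 := cs.not_isLeftDescent_iff.1 hup
    have h3 := (hB.wd2 (π y) (π z₀) (π x) s (hB.dist_symm h1)).2 h2
    exact .step hy hyx h3 (by rw [h3, h2])
  · have : y = x := hZ.inj s s y x ⟨1, one_ne_zero, by simp⟩ (.single (by simp) hyx) h1
    exact this ▸ hy

/-- Buildings are simply connected: connected coverings of buildings are injective. -/
theorem injective (hB : IsBuilding cs δ) (hZ : IsBuildingCover cs δ r π) {z z' : Z}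
    (h : SameResidue r Set.univ z z') (e : π z = π z') : z = z' := by
  have hz' : IsMinLift cs δ r π z z' := by
    clear e
    induction h with
    | refl => exact .base
    | tail _ h ih =>
      obtain ⟨s, -, h⟩ := h
      exact hZ.isMinLift_of_rel hB ih h
  exact hZ.isMinLift_unique hB _ z z' .base hz' e (Nat.lt_succ_self _)

end IsBuildingCover

end

end GraphBuilding

/-! ### The topology of the realization of a poset -/

namespace GraphBuilding

open scoped unitInterval

variable {P : Type*} [PartialOrder P]

/-- The simplex spanned by a finite set, in barycentric coordinates. -/
def simplexSet {P : Type*} (c : Finset P) : Set (P → ℝ) :=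
  {w | (∀ a, 0 ≤ w a) ∧ w.support ⊆ c ∧ ∑ a ∈ c, w a = 1}

theorem convex_simplexSet {P : Type*} (c : Finset P) : Convex ℝ (simplexSet c) := by
  intro v hv w hw a b ha hb hab
  refine ⟨fun x => ?_, fun x hx => ?_, ?_⟩
  · exact add_nonneg (mul_nonneg ha (hv.1 x)) (mul_nonneg hb (hw.1 x))
  · by_contra hxc
    have h1 : v x = 0 := by_contra fun h => hxc (hv.2.1 h)
    have h2 : w x = 0 := by_contra fun h => hxc (hw.2.1 h)
    exact hx (by simp [h1, h2])
  · simp only [Pi.add_apply, Pi.smul_apply, smul_eq_mul, Finset.sum_add_distrib,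
      ← Finset.mul_sum, hv.2.2, hw.2.2, mul_one, hab]

theorem simplexSet_mono {P : Type*} {c c' : Finset P} (h : c ⊆ c') :
    simplexSet c ⊆ simplexSet c' := by
  rintro w ⟨h1, h2, h3⟩
  refine ⟨h1, h2.trans (by exact_mod_cast h), ?_⟩
  rw [← h3]
  refine (Finset.sum_subset h fun x _ hx => ?_).symm
  by_contra h0
  exact hx (h2 h0)

open Classical in
theorem single_mem_simplexSet {P : Type*} {c : Finset P} {T : P} (h : T ∈ c) :
    (Pi.single T 1 : P → ℝ) ∈ simplexSet c := by
  refine ⟨fun a => ?_, fun a ha => ?_, ?_⟩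
  · by_cases h : a = T
    · subst h; simp
    · simp [h]
  · by_cases h' : a = T
    · subst h'; exact h
    · simp [h'] at ha
  · simp [h]

namespace PosetRealization

/-- The point of the realization with given barycentric coordinates. -/
def ofSimplex {c : Finset P} (hc : IsChain (· ≤ ·) (c : Set P)) (w : simplexSet c) :
    PosetRealization P :=
  ⟨w.1, w.2.1, c.finite_toSet.subset w.2.2.1, hc.mono w.2.2.1, by
    rw [finsum_eq_sum_of_support_subset _ w.2.2.1, w.2.2.2]⟩

theorem isOpen_iff {U : Set (PosetRealization P)} :
    IsOpen U ↔ ∀ (c : Finset P) (hc : IsChain (· ≤ ·) (c : Set P)), IsOpen (ofSimplex hc ⁻¹' U) := by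
  have h0 : IsOpen U ↔ ∀ c : {c : Finset P // IsChain (· ≤ ·) (c : Set P)},
      IsOpen[TopologicalSpace.induced (fun f => f.1.1) Pi.topologicalSpace]
        ((Subtype.val : {f : PosetRealization P // f.1.support ⊆ c.1} → PosetRealization P) ⁻¹'
          U) := by
    refine isOpen_iSup_iff.trans (forall_congr' fun c => ?_)
    exact isOpen_coinduced
  rw [h0, Subtype.forall]
  refine forall_congr' fun c => forall_congr' fun hc => ?_
  rw [isOpen_induced_iff, isOpen_induced_iff]
  refine exists_congr fun V => and_congr_right fun _ => ?_
  constructor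
  · intro h
    ext w
    exact Set.ext_iff.1 h ⟨ofSimplex hc w, w.2.2.1⟩
  · intro h
    ext ⟨x, hx⟩
    refine Set.ext_iff.1 h ⟨x.1, x.2.1, hx, ?_⟩
    rw [← finsum_eq_sum_of_support_subset _ hx, x.2.2.2.2]

theorem continuous_ofSimplex {c : Finset P} (hc : IsChain (· ≤ ·) (c : Set P)) :
    Continuous (ofSimplex hc) :=
  ⟨fun _ hU => isOpen_iff.1 hU c hc⟩

theorem continuous_dom {X : Type*} [TopologicalSpace X] {f : PosetRealization P → X}
    (h : ∀ (c : Finset P) (hc : IsChain (· ≤ ·) (c : Set P)),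
      Continuous fun w => f (ofSimplex hc w)) : Continuous f :=
  ⟨fun _ hU => isOpen_iff.2 fun c hc => (h c hc).isOpen_preimage _ hU⟩

theorem continuous_apply (a : P) : Continuous fun x : PosetRealization P => x.1 a :=
  continuous_dom fun _ _ => (_root_.continuous_apply a).comp continuous_subtype_val

theorem exists_ofSimplex (x : PosetRealization P) :
    ∃ (c : Finset P) (hc : IsChain (· ≤ ·) (c : Set P)) (w : simplexSet c),
      x = ofSimplex hc w ∧ (c : Set P) = x.1.support := by
  have hc : (x.2.2.1.toFinset : Set P) = x.1.support := x.2.2.1.coe_toFinset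
  refine ⟨x.2.2.1.toFinset, hc.symm ▸ x.2.2.2.1, ⟨x.1, x.2.1, hc.symm.subset, ?_⟩, rfl, hc⟩
  rw [← finsum_eq_sum_of_support_subset _ hc.symm.subset, x.2.2.2.2]

/-- The realization is a quotient of a disjoint union of simplices, which are convex. Local path
connectedness is required by the lifting criterion for coverings. -/
instance : LocallyPathConnectedSpace (PosetRealization P) := by
  have hs : ∀ c : {c : Finset P // IsChain (· ≤ ·) (c : Set P)},
      LocallyPathConnectedSpace (simplexSet c.1) := fun c =>
    (convex_simplexSet c.1).locallyPathConnectedSpace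
  let f : (Σ c : {c : Finset P // IsChain (· ≤ ·) (c : Set P)}, simplexSet c.1) →
    PosetRealization P := fun x => ofSimplex x.1.2 x.2
  have hf : Topology.IsQuotientMap f := by
    rw [Topology.isQuotientMap_iff]
    refine ⟨.of_isOpen_preimage_iff_isOpen fun U => ?_, fun x => ?_⟩
    · rw [isOpen_iff, isOpen_sigma_iff, Subtype.forall]
      rfl
    · obtain ⟨c, hc, w, rfl, -⟩ := exists_ofSimplex x
      exact ⟨⟨⟨c, hc⟩, w⟩, rfl⟩
  exact hf.locallyPathConnectedSpace

open Classical in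
/-- The vertex of the realization given by an element of the poset. -/
noncomputable def vertex (T : P) : PosetRealization P :=
  ofSimplex (c := {T}) (by simp) ⟨Pi.single T 1, single_mem_simplexSet (by simp)⟩

theorem support_vertex (T : P) : (vertex T).1.support = {T} := by
  classical
  exact Pi.support_single_of_ne one_ne_zero

open Classical in
/-- The segment from a point of a simplex to a vertex. -/
noncomputable def segment {c : Finset P} (hc : IsChain (· ≤ ·) (c : Set P)) {T : P}
    (hT : ∀ a ∈ c, a ≤ T ∨ T ≤ a) (x : simplexSet c × I) : PosetRealization P :=
  ofSimplex (c := insert T c) (by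
    rw [Finset.coe_insert]
    exact hc.insert fun a ha _ => (hT a ha).symm)
    ⟨(1 - x.2.1) • x.1.1 + x.2.1 • Pi.single T 1,
      convex_simplexSet _ (simplexSet_mono (Finset.subset_insert T c) x.1.2)
        (single_mem_simplexSet (Finset.mem_insert_self T c)) (sub_nonneg.2 x.2.2.2) x.2.2.1
        (by ring)⟩

theorem continuous_segment {c : Finset P} (hc : IsChain (· ≤ ·) (c : Set P)) {T : P}
    (hT : ∀ a ∈ c, a ≤ T ∨ T ≤ a) : Continuous (segment hc hT) := by
  refine (continuous_ofSimplex _).comp (Continuous.subtype_mk ?_ _)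
  fun_prop

theorem support_segment_subset {c : Finset P} (hc : IsChain (· ≤ ·) (c : Set P)) {T : P}
    (hT : ∀ a ∈ c, a ≤ T ∨ T ≤ a) (w : simplexSet c) (t : I) :
    (segment hc hT (w, t)).1.support ⊆ insert T w.1.support := by
  classical
  intro a ha
  by_contra h
  simp only [Set.mem_insert_iff, Function.mem_support, not_or, not_not] at h
  apply ha
  simp [segment, ofSimplex, h.1, h.2]

theorem segment_zero {c : Finset P} (hc : IsChain (· ≤ ·) (c : Set P)) {T : P}
    (hT : ∀ a ∈ c, a ≤ T ∨ T ≤ a) (w : simplexSet c) : segment hc hT (w, 0) = ofSimplex hc w := by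
  apply Subtype.ext
  simp [segment, ofSimplex]

theorem segment_one {c : Finset P} (hc : IsChain (· ≤ ·) (c : Set P)) {T : P}
    (hT : ∀ a ∈ c, a ≤ T ∨ T ≤ a) (w : simplexSet c) : segment hc hT (w, 1) = vertex T := by
  apply Subtype.ext
  simp [segment, ofSimplex, vertex]

/-- A point of the realization is joined to any vertex comparable with its support. -/
theorem exists_path_vertex (x : PosetRealization P) {T : P}
    (hT : ∀ a ∈ x.1.support, a ≤ T ∨ T ≤ a) :
    ∃ γ : Path x (vertex T), ∀ t, (γ t).1.support ⊆ insert T x.1.support := by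
  obtain ⟨c, hc, w, rfl, h⟩ := exists_ofSimplex x
  have hT' : ∀ a ∈ c, a ≤ T ∨ T ≤ a := fun a ha => hT a (h ▸ ha)
  exact ⟨⟨⟨fun t => segment hc hT' (w, t), (continuous_segment hc hT').comp (by fun_prop)⟩,
    segment_zero hc hT' w, segment_one hc hT' w⟩, support_segment_subset hc hT' w⟩

/-- The realization of a poset with a least element is contractible. -/
theorem contractibleSpace {b : P} (hb : ∀ a, b ≤ a) : ContractibleSpace (PosetRealization P) := by
  classical
  rw [contractible_iff_id_nullhomotopic]
  have hT : ∀ c : Finset P, ∀ a ∈ c, a ≤ b ∨ b ≤ a := fun _ a _ => Or.inr (hb a)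
  choose c hc w hx h using exists_ofSimplex (P := P)
  -- the coordinates of a segment do not depend on the simplex
  have hval : ∀ {c : Finset P} (hc : IsChain (· ≤ ·) (c : Set P)) (w : simplexSet c) (t : I),
      (segment hc (hT c) (w, t)).1 =
        (1 - t.1) • (ofSimplex hc w).1 + t.1 • (Pi.single b 1 : P → ℝ) := fun _ _ _ => rfl
  -- The contraction is built as a map into the path space: continuity there can be tested on each
  -- simplex, and uncurrying avoids any discussion of the topology of a product with the interval.
  let F : PosetRealization P → C(I, PosetRealization P) := fun x =>
    ⟨fun t => segment (hc x) (hT (c x)) (w x, t),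
      (continuous_segment (hc x) (hT (c x))).comp (by fun_prop)⟩
  have hF : Continuous F := by
    refine continuous_dom fun c' hc' => ?_
    let G : C(simplexSet c' × I, PosetRealization P) := ⟨_, continuous_segment hc' (hT c')⟩
    have : (fun w' => F (ofSimplex hc' w')) = G.curry := by
      funext w'
      refine ContinuousMap.ext fun t => Subtype.ext ?_
      refine (hval (hc _) _ _).trans (Eq.trans ?_ (hval hc' w' t).symm)
      rw [← hx]
    rw [this]
    exact G.curry.continuous
  refine ⟨vertex b, ⟨⟨⟨fun x => F x.2 x.1, ?_⟩, fun x => ?_, fun x => ?_⟩⟩⟩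
  · exact (ContinuousMap.continuous_uncurry_of_continuous ⟨F, hF⟩).comp continuous_swap
  · exact (segment_zero (hc x) (hT (c x)) _).trans (hx x).symm
  · exact segment_one (hc x) (hT (c x)) _

theorem isOpen_exists_le (T : P) : IsOpen {x : PosetRealization P | ∃ a ∈ x.1.support, a ≤ T} := by
  have : {x : PosetRealization P | ∃ a ∈ x.1.support, a ≤ T} =
      ⋃ a ∈ {a | a ≤ T}, {x | x.1 a ≠ 0} := by
    ext x
    simp [and_comm]
  rw [this]
  exact isOpen_biUnion fun a _ => isOpen_ne_fun (continuous_apply a) continuous_const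

theorem exists_least (x : PosetRealization P) :
    ∃ T ∈ x.1.support, ∀ a ∈ x.1.support, T ≤ a := by
  have hne : x.1.support.Nonempty := by
    rw [Set.nonempty_iff_ne_empty]
    intro h
    have h1 := x.2.2.2.2
    rw [Function.support_eq_empty_iff] at h
    simp [h] at h1
  obtain ⟨T, hT⟩ := x.2.2.1.exists_minimal hne
  refine ⟨T, hT.1, fun a ha => ?_⟩
  rcases x.2.2.2.1.total hT.1 ha with h | h
  exacts [h, hT.2 ha h]

end PosetRealization

/-! ### The Davis chamber -/

section

variable {S : Type*} {M : CoxeterMatrix S}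

/-- The empty spherical subset. -/
def sphericalBot (M : CoxeterMatrix S) : SphericalPoset M :=
  ⟨∅, by simp⟩

theorem sphericalBot_le (T : SphericalPoset M) : sphericalBot M ≤ T := Set.empty_subset T.1

/-- The group is dihedral: `⟨ab⟩ ∪ ⟨ab⟩b` contains `1` and is stable under left multiplication by
`a` and by `b`. -/
theorem finite_closure_pair {G : Type*} [Group G] {a b : G} (ha : a * a = 1) (hb : b * b = 1)
    {k : ℕ} (hk : k ≠ 0) (h : (a * b) ^ k = 1) : (Subgroup.closure {a, b} : Set G).Finite := by
  have hfin : (Subgroup.zpowers (a * b) : Set G).Finite :=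
    by
    rw [finite_zpowers]
    exact isOfFinOrder_iff_pow_eq_one.2 ⟨k, Nat.pos_of_ne_zero hk, h⟩
  have hb' : b⁻¹ = b := inv_eq_of_mul_eq_one_left hb
  have ha' : a⁻¹ = a := inv_eq_of_mul_eq_one_left ha
  have hinv : ∀ x ∈ Subgroup.zpowers (a * b), b * x * b ∈ Subgroup.zpowers (a * b) := by
    rintro _ ⟨z, rfl⟩
    have : b * (a * b) ^ z * b = ((a * b) ^ z)⁻¹ := by
      rw [← inv_zpow, mul_inv_rev, ha', hb', show b * a = b * (a * b) * b⁻¹ by group, conj_zpow,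
        hb']
    simp only [this]
    exact inv_mem ⟨z, rfl⟩
  refine (hfin.union (hfin.image (· * b))).subset fun x hx => ?_
  have hleft : ∀ y, y ∈ (Subgroup.zpowers (a * b) : Set G) ∪
      (· * b) '' (Subgroup.zpowers (a * b) : Set G) →
      b * y ∈ (Subgroup.zpowers (a * b) : Set G) ∪
        (· * b) '' (Subgroup.zpowers (a * b) : Set G) := by
    rintro y (hy | ⟨y, hy, rfl⟩)
    · exact Or.inr ⟨_, hinv y hy, by simp [mul_assoc, hb]⟩
    · exact Or.inl (by simpa [mul_assoc] using hinv y hy)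
  have hab : ∀ y, y ∈ (Subgroup.zpowers (a * b) : Set G) ∪
      (· * b) '' (Subgroup.zpowers (a * b) : Set G) →
      a * b * y ∈ (Subgroup.zpowers (a * b) : Set G) ∪
        (· * b) '' (Subgroup.zpowers (a * b) : Set G) := by
    rintro y (hy | ⟨y, hy, rfl⟩)
    · exact Or.inl (mul_mem (Subgroup.mem_zpowers _) hy)
    · exact Or.inr ⟨_, mul_mem (Subgroup.mem_zpowers _) hy, by simp [mul_assoc]⟩
  have hgen : ∀ g ∈ ({a, b} : Set G), ∀ y, y ∈ (Subgroup.zpowers (a * b) : Set G) ∪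
      (· * b) '' (Subgroup.zpowers (a * b) : Set G) →
      g * y ∈ (Subgroup.zpowers (a * b) : Set G) ∪
        (· * b) '' (Subgroup.zpowers (a * b) : Set G) := by
    rintro g (rfl | rfl) y hy
    · have := hab _ (hleft y hy)
      rwa [mul_assoc, ← mul_assoc b, hb, one_mul] at this
    · exact hleft y hy
  induction hx using Subgroup.closure_induction_left with
  | one => exact Or.inl (one_mem _)
  | mul_left g hg y _ ih => exact hgen g hg y ih
  | inv_mul_cancel g hg y _ ih =>
    have : g⁻¹ = g := by rcases hg with rfl | rfl <;> assumption
    rw [this]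
    exact hgen g hg y ih

theorem simple_mul_self (M : CoxeterMatrix S) (s : S) : M.simple s * M.simple s = 1 :=
  M.toCoxeterSystem.simple_mul_simple_self s

/-- The spherical subset formed by two generators whose product has finite order. -/
def sphericalPair (M : CoxeterMatrix S) {s t : S} {k : ℕ} (hk : k ≠ 0)
    (h : (M.simple s * M.simple t) ^ k = 1) : SphericalPoset M :=
  ⟨{s, t}, by
    rw [Set.image_pair]
    exact finite_closure_pair (simple_mul_self M s) (simple_mul_self M t) hk h⟩

/-- The spherical subset formed by a single generator. -/
def sphericalSingle (M : CoxeterMatrix S) (s : S) : SphericalPoset M :=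
  ⟨{s}, by
    simpa using finite_closure_pair (simple_mul_self M s) (simple_mul_self M s) one_ne_zero
      (by rw [pow_one, simple_mul_self])⟩

instance : ContractibleSpace (DavisChamber M) :=
  PosetRealization.contractibleSpace (sphericalBot_le (M := M))

theorem vertex_mem_mirror_iff {s : S} {T : SphericalPoset M} :
    PosetRealization.vertex T ∈ mirror M s ↔ s ∈ T.1 := by
  simp only [mirror, PosetRealization.support_vertex, Set.mem_ofPred_eq, Set.mem_singleton_iff,
    forall_eq]

/-- Any point of a mirror is joined within it to the vertex given by its generator. -/
theorem exists_path_mirror {s : S} {x : DavisChamber M} (hx : x ∈ mirror M s) :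
    ∃ γ : Path x (PosetRealization.vertex (sphericalSingle M s)), ∀ t, γ t ∈ mirror M s := by
  obtain ⟨γ, hγ⟩ := x.exists_path_vertex (T := sphericalSingle M s) fun a ha =>
    Or.inr (Set.singleton_subset_iff.2 (hx a ha))
  refine ⟨γ, fun t a ha => ?_⟩
  rcases hγ t ha with rfl | h
  exacts [rfl, hx a h]

end

end GraphBuilding

/-! ### Realizations of chamber systems and their coverings -/

namespace GraphBuilding

namespace Realization

variable {S X K : Type*} {adj : S → X → X → Prop} {mir : S → Set K}

theorem ind {p : Realization adj mir → Prop} (h : ∀ C x, p (mk adj mir C x)) (y) : p y :=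
  Quot.ind (fun a => h a.1 a.2) y

/-- Each elementary gluing keeps the point `x` fixed and crosses a panel whose mirror contains `x`,
so chains of gluings are galleries with types in that set. -/
theorem mk_eq_iff (hs : ∀ s C D, adj s C D → adj s D C) {C D : X} {x y : K} :
    mk adj mir C x = mk adj mir D y ↔ x = y ∧ SameResidue adj {s | x ∈ mir s} C D := by
  constructor
  · intro h
    have h' := Quot.eqvGen_exact h
    have key : ∀ a b : (Σ _ : X, K),
        Relation.EqvGen (fun a b => a.2 = b.2 ∧ ∃ s, a.2 ∈ mir s ∧ adj s a.1 b.1) a b →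
        a.2 = b.2 ∧ SameResidue adj {s | a.2 ∈ mir s} a.1 b.1 := by
      intro a b hab
      induction hab with
      | rel a b h =>
        obtain ⟨h1, s, h2, h3⟩ := h
        exact ⟨h1, .single (T := {s | a.2 ∈ mir s}) h2 h3⟩
      | refl a => exact ⟨rfl, .refl _⟩
      | symm a b _ ih => exact ⟨ih.1.symm, ih.1 ▸ ih.2.symm hs⟩
      | trans a b c _ _ ih ih' => exact ⟨ih.1.trans ih'.1, ih.2.trans (ih.1 ▸ ih'.2)⟩
    exact key _ _ h'
  · rintro ⟨rfl, h⟩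
    induction h with
    | refl => rfl
    | tail _ h ih =>
      obtain ⟨s, hs, h⟩ := h
      exact ih.trans (Quot.sound ⟨rfl, s, hs, h⟩)

variable [TopologicalSpace K]

theorem isOpen_iff {U : Set (Realization adj mir)} :
    IsOpen U ↔ ∀ C, IsOpen (mk adj mir C ⁻¹' U) :=
  (isQuotientMap_quot_mk.isOpen_preimage (s := U)).symm.trans isOpen_sigma_iff

theorem continuous_mk (C : X) : Continuous (mk adj mir C) :=
  ⟨fun _ hU => isOpen_iff.1 hU C⟩

instance [LocallyPathConnectedSpace K] : LocallyPathConnectedSpace (Realization adj mir) :=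
  inferInstanceAs (LocallyPathConnectedSpace (Quot _))

end Realization

section

variable {S X Z : Type*} {M : CoxeterMatrix S} {adj : S → X → X → Prop}
  {adjZ : S → Z → Z → Prop} {π : Z → X}

/-- The set of generators whose mirrors contain a point of the Davis chamber is contained in any
member of the support of the point. -/
theorem mirrors_subset {x : DavisChamber M} {T T' : SphericalPoset M} (hT : T ∈ x.1.support)
    (h : T ≤ T') : {s | x ∈ mirror M s} ⊆ T'.1 :=
  fun _ hs => h (hs T hT)

/-- A chamber system `Z` covers the chamber system `X`: panels are mapped bijectively to panels,
and spherical residues are mapped injectively. -/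
structure IsChamberCover (M : CoxeterMatrix S) (adj : S → X → X → Prop)
    (adjZ : S → Z → Z → Prop) (π : Z → X) : Prop where
  symm : ∀ s z z', adjZ s z z' → adjZ s z' z
  map : ∀ s z z', adjZ s z z' → SameResidue adj {s} (π z) (π z')
  lift : ∀ s z b, adj s (π z) b → ∃ z', π z' = b ∧ adjZ s z z'
  inj : ∀ (T : SphericalPoset M) z z', SameResidue adjZ T.1 z z' → π z = π z' → z = z'

namespace IsChamberCover

theorem lift_residue (hZ : IsChamberCover M adj adjZ π) {T : Set S} {z : Z} {b : X}
    (h : SameResidue adj T (π z) b) : ∃ z', π z' = b ∧ SameResidue adjZ T z z' := by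
  induction h with
  | refl => exact ⟨z, rfl, .refl z⟩
  | tail _ h ih =>
    obtain ⟨y, rfl, hy⟩ := ih
    obtain ⟨s, hs, h⟩ := h
    obtain ⟨z', rfl, h'⟩ := hZ.lift s y _ h
    exact ⟨z', rfl, hy.trans (.single hs h')⟩

end IsChamberCover

/-- The open star of a residue of spherical type in the realization. -/
def residueStar (M : CoxeterMatrix S) (adj : S → X → X → Prop) (T : SphericalPoset M) (b : X) :
    Set (Realization adj (mirror M)) :=
  {y | ∃ C x, y = Realization.mk _ _ C x ∧ SameResidue adj T.1 b C ∧ ∃ a ∈ x.1.support, a ≤ T}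

/-- Membership does not depend on the representative: the gluings at `x` have types in every member
of its support, hence in `T`, and cannot leave the residue. -/
theorem mk_mem_residueStar (hs : ∀ s C D, adj s C D → adj s D C) {T : SphericalPoset M} {b C : X}
    {x : DavisChamber M} : Realization.mk adj (mirror M) C x ∈ residueStar M adj T b ↔
      SameResidue adj T.1 b C ∧ ∃ a ∈ x.1.support, a ≤ T := by
  constructor
  · rintro ⟨D, y, h, hD, hy⟩
    obtain ⟨rfl, h'⟩ := (Realization.mk_eq_iff hs).1 h
    obtain ⟨a, ha, haT⟩ := hy
    exact ⟨hD.trans ((h'.symm hs).mono (mirrors_subset ha haT)), a, ha, haT⟩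
  · rintro ⟨h1, h2⟩
    exact ⟨C, x, rfl, h1, h2⟩

theorem isOpen_residueStar (hs : ∀ s C D, adj s C D → adj s D C) (T : SphericalPoset M) (b : X) :
    IsOpen (residueStar M adj T b) := by
  refine Realization.isOpen_iff.2 fun C => ?_
  by_cases h : SameResidue adj T.1 b C
  · convert! PosetRealization.isOpen_exists_le T using 1
    ext x
    simp [mk_mem_residueStar hs, h]
  · convert! isOpen_empty using 1
    ext x
    simp [mk_mem_residueStar hs, h]

namespace IsChamberCover

/-- The map of realizations induced by a covering of chamber systems. -/
def realizationMap (hs : ∀ s C D, adj s C D → adj s D C) (hZ : IsChamberCover M adj adjZ π) :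
    Realization adjZ (mirror M) → Realization adj (mirror M) :=
  Quot.lift (fun a => Realization.mk adj (mirror M) (π a.1) a.2) fun a b h => by
    obtain ⟨h1, s, h2, h3⟩ := h
    exact (Realization.mk_eq_iff hs).2
      ⟨h1, (hZ.map s _ _ h3).mono (T' := {s | a.2 ∈ mirror M s})
        (Set.singleton_subset_iff.2 h2)⟩

variable (hs : ∀ s C D, adj s C D → adj s D C) (hZ : IsChamberCover M adj adjZ π)

theorem realizationMap_mk (z : Z) (x : DavisChamber M) :
    hZ.realizationMap hs (Realization.mk adjZ (mirror M) z x) = Realization.mk _ _ (π z) x :=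
  rfl

theorem continuous_realizationMap : Continuous (hZ.realizationMap hs) := by
  refine ⟨fun U hU => Realization.isOpen_iff.2 fun z => ?_⟩
  exact Realization.isOpen_iff.1 hU (π z)

theorem isOpenMap_realizationMap : IsOpenMap (hZ.realizationMap hs) := by
  intro U hU
  refine Realization.isOpen_iff.2 fun b => ?_
  have : Realization.mk adj (mirror M) b ⁻¹' (hZ.realizationMap hs '' U) =
      ⋃ z ∈ {z | π z = b}, Realization.mk adjZ (mirror M) z ⁻¹' U := by
    ext x
    simp only [Set.mem_preimage, Set.mem_iUnion, Set.mem_ofPred_eq, exists_prop]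
    constructor
    · rintro ⟨y, hy, h⟩
      induction y using Realization.ind with
      | h z x' =>
      rw [realizationMap_mk] at h
      obtain ⟨rfl, h'⟩ := (Realization.mk_eq_iff hs).1 h
      obtain ⟨z', rfl, hz'⟩ := hZ.lift_residue h'
      exact ⟨z', rfl, (Realization.mk_eq_iff hZ.symm).2 ⟨rfl, hz'⟩ ▸ hy⟩
    · rintro ⟨z, rfl, hz⟩
      exact ⟨_, hz, rfl⟩
  rw [this]
  exact isOpen_biUnion fun z _ => Realization.isOpen_iff.1 hU z

theorem injOn_realizationMap (T : SphericalPoset M) (z₀ : Z) :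
    Set.InjOn (hZ.realizationMap hs) (residueStar M adjZ T z₀) := by
  rintro _ ⟨z, x, rfl, hz, a, ha, haT⟩ _ ⟨z', x', rfl, hz', -⟩ h
  obtain ⟨rfl, h'⟩ := (Realization.mk_eq_iff hs).1 h
  obtain ⟨y, hy, hzy⟩ := hZ.lift_residue h'
  have h1 := hzy.mono (mirrors_subset ha haT)
  have h2 : z' = y := hZ.inj T z' y (((hz.trans h1).symm hZ.symm).trans hz' |>.symm hZ.symm) hy.symm
  exact (Realization.mk_eq_iff hZ.symm).2 ⟨rfl, h2 ▸ hzy⟩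

theorem surjOn_realizationMap (T : SphericalPoset M) (z₀ : Z) :
    Set.SurjOn (hZ.realizationMap hs) (residueStar M adjZ T z₀)
      (residueStar M adj T (π z₀)) := by
  rintro _ ⟨b, x, rfl, hb, hx⟩
  obtain ⟨z, rfl, hz⟩ := hZ.lift_residue hb
  exact ⟨_, ⟨z, x, rfl, hz, hx⟩, rfl⟩

theorem preimage_residueStar_subset (T : SphericalPoset M) (b₀ : X) :
    hZ.realizationMap hs ⁻¹' residueStar M adj T b₀ ⊆
      ⋃ i : {z // π z = b₀}, residueStar M adjZ T i.1 := by
  intro y hy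
  induction y using Realization.ind with
  | h z x =>
  obtain ⟨h1, h2⟩ := (mk_mem_residueStar hs).1 hy
  obtain ⟨z₀, h3, h4⟩ := hZ.lift_residue (h1.symm hs)
  exact Set.mem_iUnion.2 ⟨⟨z₀, h3⟩, z, x, rfl, h4.symm hZ.symm, h2⟩

/-- For `T` least in the support of the point, the star of the `T`-residue is evenly covered, with
one sheet for each chamber over `b₀`. Injectivity on spherical residues makes each sheet map
injectively and makes the sheets disjoint. -/
theorem isCoveringMap_realizationMap : IsCoveringMap (hZ.realizationMap hs) := by
  intro y
  induction y using Realization.ind with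
  | h b₀ x₀ =>
  obtain ⟨T, hT, -⟩ := x₀.exists_least
  have hy : Realization.mk adj (mirror M) b₀ x₀ ∈ residueStar M adj T b₀ :=
    ⟨b₀, x₀, rfl, .refl _, T, hT, le_rfl⟩
  have hopen := isOpen_residueStar (M := M) hs T b₀
  have hsub := hZ.preimage_residueStar_subset hs T b₀
  -- Surjectivity of `π` is not part of a chamber cover, so fibres may be empty.
  rcases isEmpty_or_nonempty {z // π z = b₀} with h | h
  · rw [Set.iUnion_of_empty, Set.subset_empty_iff] at hsub
    exact (IsEvenlyCovered.of_preimage_eq_empty PEmpty.{1} (hopen.mem_nhds hy)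
      hsub).to_isEvenlyCovered_preimage
  · have : Nonempty Z := ⟨h.some.1⟩
    have : Nonempty (Realization adj (mirror M) → Realization adjZ (mirror M)) :=
      ⟨fun _ => Realization.mk _ _ this.some x₀⟩
    let _ : TopologicalSpace {z // π z = b₀} := ⊥
    have : DiscreteTopology {z // π z = b₀} := ⟨rfl⟩
    refine (IsEvenlyCovered.of_trivialization
      (t := IsOpen.trivializationDiscrete
        (fun i : {z // π z = b₀} => residueStar M adjZ T i.1) (residueStar M adj T b₀) hopen
        (fun i W hW => ?_) (fun i => hZ.injOn_realizationMap hs T i.1)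
        (fun i => ?_) ?_ hsub) hy).to_isEvenlyCovered_preimage
    · refine ⟨fun h => (h.preimage (hZ.continuous_realizationMap hs)).inter
        (isOpen_residueStar hZ.symm T i.1), fun h => ?_⟩
      have h1 := hZ.isOpenMap_realizationMap hs _ h
      rw [Set.inter_comm, Set.image_inter_preimage, Set.inter_eq_right.2] at h1
      · exact h1
      · have := hZ.surjOn_realizationMap hs T i.1
        rw [i.2] at this
        exact hW.trans this
    · have := hZ.surjOn_realizationMap hs T i.1
      rwa [i.2] at this
    · intro i j hij
      rw [Function.onFun, Set.disjoint_left]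
      rintro _ ⟨z, x, rfl, hz, -⟩ h
      have h' := ((mk_mem_residueStar hZ.symm).1 h).1
      exact hij (Subtype.ext (hZ.inj T _ _ (hz.trans (h'.symm hZ.symm)) (i.2.trans j.2.symm)))

end IsChamberCover

end

end GraphBuilding

/-! ### The chamber system of a graph product -/

namespace GraphBuilding

/-- Adjacency relations whose reflexive closures are equivalence relations. -/
structure IsChamberSystem {S X : Type*} (adj : S → X → X → Prop) : Prop where
  symm : ∀ s C D, adj s C D → adj s D C
  trans : ∀ s C D E, adj s C D → adj s D E → adj s C E ∨ C = E

theorem IsChamberSystem.panel {S X : Type*} {adj : S → X → X → Prop} (h : IsChamberSystem adj)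
    {s : S} {C D : X} (hr : SameResidue adj {s} C D) : adj s C D ∨ C = D := by
  induction hr with
  | refl => exact Or.inr rfl
  | tail _ h1 ih =>
    obtain ⟨t, rfl, h1⟩ := h1
    rcases ih with ih | rfl
    exacts [h.trans _ _ _ _ ih h1, Or.inl h1]

namespace GraphProduct

variable {I : Type*} {Γ : SimpleGraph I} {S W B : I → Type*} [∀ i, Group (W i)]
  {M : ∀ i, CoxeterMatrix (S i)} {cs : ∀ i, CoxeterSystem (M i) (W i)} {δ : ∀ i, B i → B i → W i}
  {Y : Type*} [TopologicalSpace Y] {q : Y → GPRealization Γ cs δ}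

/-- The Davis chamber is contractible and locally path connected, so its copies lift through any
prescribed point. -/
theorem exists_lift_eq (hq : IsCoveringMap q) {y : Y} {b : ∀ i, B i}
    {x : DavisChamber (gpMatrix Γ M)} (h : q y = Realization.mk _ _ b x) :
    ∃ C : GraphProduct q, C.base = b ∧ C.lift x = y := by
  obtain ⟨F, ⟨h1, h2⟩, -⟩ := hq.existsUnique_continuousMap_lifts
    (⟨_, Realization.continuous_mk b⟩ : C(DavisChamber (gpMatrix Γ M), GPRealization Γ cs δ)) x y h
  exact ⟨⟨b, F, fun x => congrFun h2 x⟩, rfl, h1⟩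

theorem eq_of_lift_eq (hq : IsCoveringMap q) {C D : GraphProduct q} (hb : C.base = D.base)
    {x : DavisChamber (gpMatrix Γ M)} (h : C.lift x = D.lift x) : C = D := by
  refine GraphProduct.ext hb (ContinuousMap.coe_injective ?_)
  refine hq.eq_of_comp_eq C.lift.continuous D.lift.continuous ?_ x h
  funext x
  rw [Function.comp_apply, Function.comp_apply, C.comm, D.comm, hb]

theorem exists_mem (hq : IsCoveringMap q) (y : Y) : ∃ (C : GraphProduct q) (x : _), C.lift x = y := by
  obtain ⟨⟨b, x⟩, h⟩ := Quot.exists_rep (q y)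
  obtain ⟨C, -, h⟩ := exists_lift_eq hq (b := b) (x := x) h.symm
  exact ⟨C, x, h⟩

theorem lift_eq_of_sameResidue {T : Set (Σ i, S i)} {C D : GraphProduct q}
    (h : SameResidue (GraphProduct.sEquiv q) T C D) {x : DavisChamber (gpMatrix Γ M)}
    (hx : ∀ s ∈ T, x ∈ mirror (gpMatrix Γ M) s) : C.lift x = D.lift x := by
  induction h with
  | refl => rfl
  | tail _ h ih =>
    obtain ⟨s, hs, h⟩ := h
    exact ih.trans (h x (hx s hs))

theorem sEquiv_symm (s : Σ i, S i) (C D : GraphProduct q) (h : GraphProduct.sEquiv q s C D) :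
    GraphProduct.sEquiv q s D C :=
  fun x hx => (h x hx).symm

variable (hadj : IsChamberSystem (prodAdj cs δ))
include hadj

theorem lift_eq_iff {C D : GraphProduct q} {x x' : DavisChamber (gpMatrix Γ M)}
    (h : C.lift x = D.lift x') :
    x = x' ∧ SameResidue (prodAdj cs δ) {s | x ∈ mirror (gpMatrix Γ M) s} C.base D.base := by
  rw [← Realization.mk_eq_iff hadj.symm]
  exact (C.comm x).symm.trans ((congrArg q h).trans (D.comm x'))

theorem base_of_sEquiv {s : Σ i, S i} {C D : GraphProduct q} (h : GraphProduct.sEquiv q s C D) :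
    SameResidue (prodAdj cs δ) {s} C.base D.base := by
  have h1 := h (PosetRealization.vertex (sphericalSingle _ s)) (vertex_mem_mirror_iff.2 rfl)
  exact (lift_eq_iff hadj h1).2.mono fun t ht => vertex_mem_mirror_iff.1 ht

/-- The mirror is path connected through the vertex `{s}`, and both lifts have the same image below
on it, so agreement at this vertex spreads by uniqueness of path lifting. -/
theorem sEquiv_of_lift_eq (hq : IsCoveringMap q) {s : Σ i, S i} {C D : GraphProduct q}
    (hb : SameResidue (prodAdj cs δ) {s} C.base D.base)
    (h : C.lift (PosetRealization.vertex (sphericalSingle _ s)) =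
      D.lift (PosetRealization.vertex (sphericalSingle _ s))) : GraphProduct.sEquiv q s C D := by
  intro x hx
  obtain ⟨γ, hγ⟩ := exists_path_mirror hx
  have h1 : C.lift ∘ γ = D.lift ∘ γ := by
    refine hq.eq_of_comp_eq (C.lift.continuous.comp γ.continuous)
      (D.lift.continuous.comp γ.continuous) ?_ 1 (by simpa using h)
    funext t
    simp only [Function.comp_apply]
    rw [C.comm, D.comm, Realization.mk_eq_iff hadj.symm]
    exact ⟨rfl, hb.mono (Set.singleton_subset_iff.2 (by exact hγ t))⟩
  simpa using congrFun h1 0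

/-- The vertex `T` lies in every mirror of type in `T`. A gallery of type `T` therefore keeps the
lift of this vertex fixed, and a lifted chamber is determined by its projection and one point. -/
theorem isChamberCover (hq : IsCoveringMap q) : IsChamberCover (gpMatrix Γ M) (prodAdj cs δ)
    (GraphProduct.sEquiv q) GraphProduct.base where
  symm := sEquiv_symm
  map _ _ _ h := base_of_sEquiv hadj h
  lift s C b h := by
    have hr : SameResidue (prodAdj cs δ) {s} C.base b := .single (Set.mem_singleton s) h
    obtain ⟨D, rfl, hD⟩ := exists_lift_eq hq
      (y := C.lift (PosetRealization.vertex (sphericalSingle _ s))) (b := b)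
      (x := PosetRealization.vertex (sphericalSingle _ s)) (by
        rw [C.comm, Realization.mk_eq_iff hadj.symm]
        exact ⟨rfl, hr.mono (Set.singleton_subset_iff.2 (by
          exact vertex_mem_mirror_iff.2 rfl))⟩)
    exact ⟨D, rfl, sEquiv_of_lift_eq hadj hq hr hD.symm⟩
  inj T _ _ h e := eq_of_lift_eq hq e (lift_eq_of_sameResidue h (x := PosetRealization.vertex T)
    fun _ hs => vertex_mem_mirror_iff.2 hs)

theorem sameResidue_of_lift_eq (hq : IsCoveringMap q) {C D : GraphProduct q}
    {x x' : DavisChamber (gpMatrix Γ M)} (h : C.lift x = D.lift x') :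
    SameResidue (GraphProduct.sEquiv q) Set.univ C D := by
  obtain ⟨rfl, hr⟩ := lift_eq_iff hadj h
  obtain ⟨E, hE, hCE⟩ := (isChamberCover hadj hq).lift_residue hr
  have h1 := lift_eq_of_sameResidue hCE (x := x) fun _ hs => hs
  rw [← eq_of_lift_eq hq hE (h1.symm.trans h)]
  exact hCE.mono (Set.subset_univ _)

omit hadj in
-- The universal cover carries the weak topology of its chambers. This transfers from the base
-- through local homeomorphisms, since the copies over a chamber `b` are exactly the lifts of `b`.
theorem isOpen_iff_lift (hq : IsCoveringMap q) {V : Set Y} :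
    IsOpen V ↔ ∀ C : GraphProduct q, IsOpen (C.lift ⁻¹' V) := by
  refine ⟨fun h C => h.preimage C.lift.continuous, fun h => ?_⟩
  rw [isOpen_iff_forall_mem_open]
  intro y hy
  obtain ⟨e, hye, rfl⟩ := hq.isLocalHomeomorph y
  have h1 : IsOpen (e '' (e.source ∩ V)) := by
    refine Realization.isOpen_iff.2 fun b => ?_
    have : Realization.mk _ _ b ⁻¹' (e '' (e.source ∩ V)) =
        ⋃ C ∈ {C : GraphProduct e | C.base = b}, C.lift ⁻¹' (e.source ∩ V) := by
      ext x
      simp only [Set.mem_preimage, Set.mem_iUnion, Set.mem_ofPred_eq, exists_prop]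
      constructor
      · rintro ⟨y', hy', h'⟩
        obtain ⟨C, hC, hx⟩ := exists_lift_eq hq h'
        exact ⟨C, hC, hx ▸ hy'⟩
      · rintro ⟨C, rfl, hC⟩
        exact ⟨_, hC, C.comm x⟩
    rw [this]
    exact isOpen_biUnion fun C _ => (e.open_source.preimage C.lift.continuous).inter (h C)
  refine ⟨e.source ∩ e ⁻¹' (e '' (e.source ∩ V)), ?_, e.isOpen_inter_preimage h1,
    hye, y, ⟨hye, hy⟩, rfl⟩
  rintro z ⟨hz, z', ⟨hz', hV⟩, he⟩
  rwa [← e.injOn hz' hz he]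

omit hadj in
theorem locallyPathConnectedSpace (hq : IsCoveringMap q) : LocallyPathConnectedSpace Y := by
  let f : (Σ _ : GraphProduct q, DavisChamber (gpMatrix Γ M)) → Y := fun a => a.1.lift a.2
  have hf : Topology.IsQuotientMap f := by
    rw [Topology.isQuotientMap_iff]
    refine ⟨.of_isOpen_preimage_iff_isOpen fun U => ?_, fun y => ?_⟩
    · rw [isOpen_iff_lift hq, isOpen_sigma_iff]
      rfl
    · obtain ⟨C, x, h⟩ := exists_mem hq y
      exact ⟨⟨C, x⟩, h⟩
  exact hf.locallyPathConnectedSpace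

/-- The graph product is connected. -/
theorem sameResidue_univ (hq : IsUniversalCovering q) (C D : GraphProduct q) :
    SameResidue (GraphProduct.sEquiv q) Set.univ C D := by
  have := hq.simplyConnected
  have hc := hq.isCoveringMap
  -- The union of the chambers joined to `C` by galleries is clopen in the connected space `Y`.
  let V : Set Y := {y | ∃ E x, E.lift x = y ∧ SameResidue (GraphProduct.sEquiv q) Set.univ C E}
  have key : ∀ E x, E.lift x ∈ V ↔ SameResidue (GraphProduct.sEquiv q) Set.univ C E := by
    intro E x
    constructor
    · rintro ⟨E', x', h, h'⟩
      exact h'.trans (sameResidue_of_lift_eq hadj hc h)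
    · exact fun h => ⟨E, x, rfl, h⟩
  have hV : IsClopen V := by
    refine ⟨⟨(isOpen_iff_lift hc).2 fun E => ?_⟩, (isOpen_iff_lift hc).2 fun E => ?_⟩
    all_goals
      by_cases h : SameResidue (GraphProduct.sEquiv q) Set.univ C E
    · convert! isOpen_empty using 1
      ext x
      simp [key, h]
    · convert! isOpen_univ using 1
      ext x
      simp [key, h]
    · convert! isOpen_univ using 1
      ext x
      simp [key, h]
    · convert! isOpen_empty using 1
      ext x
      simp [key, h]
  let o : DavisChamber (gpMatrix Γ M) := PosetRealization.vertex (sphericalBot _)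
  have h1 := hV.eq_univ ⟨C.lift o, (key C o).2 (.refl _)⟩
  exact (key D o).1 (h1 ▸ Set.mem_univ _)

/-- The universal property of the graph product: it maps to every covering of the product
building. -/
theorem exists_map (hq : IsUniversalCovering q) {Z : Type*} {adjZ : (Σ i, S i) → Z → Z → Prop}
    {π : Z → ∀ i, B i} (hZ : IsChamberCover (gpMatrix Γ M) (prodAdj cs δ) adjZ π)
    (C₁ : GraphProduct q) (z₁ : Z) (h₁ : π z₁ = C₁.base) :
    ∃ ψ : GraphProduct q → Z, (∀ C, π (ψ C) = C.base) ∧ ψ C₁ = z₁ ∧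
      ∀ s C D, GraphProduct.sEquiv q s C D → SameResidue adjZ {s} (ψ C) (ψ D) := by
  have := hq.simplyConnected
  have hc := hq.isCoveringMap
  have := locallyPathConnectedSpace hc
  let o : DavisChamber (gpMatrix Γ M) := PosetRealization.vertex (sphericalBot _)
  have hcov := hZ.isCoveringMap_realizationMap hadj.symm
  obtain ⟨g, ⟨hg₁, hg⟩, -⟩ := hcov.existsUnique_continuousMap_lifts
    (⟨q, hc.continuous⟩ : C(Y, GPRealization Γ cs δ)) (C₁.lift o)
    (Realization.mk adjZ (mirror (gpMatrix Γ M)) z₁ o) (by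
      rw [IsChamberCover.realizationMap_mk, h₁]
      exact (C₁.comm o).symm)
  have hgq : ∀ y, hZ.realizationMap hadj.symm (g y) = q y := congrFun hg
  -- The lift `g` sends chambers to chambers: on the copy of `C` it agrees at `o` with the copy of a
  -- suitable `z`, and both have the same image below.
  have key : ∀ C : GraphProduct q, ∃ z, π z = C.base ∧
      ∀ x, g (C.lift x) = Realization.mk adjZ (mirror (gpMatrix Γ M)) z x := by
    intro C
    obtain ⟨⟨z', x'⟩, h⟩ := Quot.exists_rep (g (C.lift o))
    change Realization.mk adjZ (mirror (gpMatrix Γ M)) z' x' = _ at h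
    have h1 := hgq (C.lift o)
    rw [← h, IsChamberCover.realizationMap_mk, C.comm, Realization.mk_eq_iff hadj.symm] at h1
    obtain ⟨rfl, h1⟩ := h1
    obtain ⟨z, hz, hr⟩ := hZ.lift_residue h1
    refine ⟨z, hz, congrFun (hcov.eq_of_comp_eq (g.continuous.comp C.lift.continuous)
      (Realization.continuous_mk z) ?_ o ?_)⟩
    · funext x
      simp only [Function.comp_apply]
      rw [hgq, C.comm, IsChamberCover.realizationMap_mk, hz]
    · exact h.symm.trans ((Realization.mk_eq_iff hZ.symm).2 ⟨rfl, hr⟩)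
  choose ψ hψ hψg using key
  refine ⟨ψ, hψ, ?_, fun s C D h => ?_⟩
  · have h1 := (hψg C₁ o).symm.trans hg₁
    rw [Realization.mk_eq_iff hZ.symm] at h1
    refine hZ.inj (sphericalBot _) _ _ (h1.2.mono fun s hs => ?_) ((hψ C₁).trans h₁.symm)
    exact vertex_mem_mirror_iff.1 hs
  · have h1 := h (PosetRealization.vertex (sphericalSingle _ s)) (vertex_mem_mirror_iff.2 rfl)
    have h2 := (hψg C _).symm.trans ((congrArg g h1).trans (hψg D _))
    rw [Realization.mk_eq_iff hZ.symm] at h2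
    exact h2.2.mono fun t ht => vertex_mem_mirror_iff.1 ht

/-- Agreement at one chamber propagates along galleries, because a panel of `Z` injects into the
base. -/
theorem map_ext (hq : IsUniversalCovering q) {Z : Type*} {adjZ : (Σ i, S i) → Z → Z → Prop}
    {π : Z → ∀ i, B i} (hZ : IsChamberCover (gpMatrix Γ M) (prodAdj cs δ) adjZ π)
    {ψ ψ' : GraphProduct q → Z} (hb : ∀ C, π (ψ C) = π (ψ' C))
    (hψ : ∀ s C D, GraphProduct.sEquiv q s C D → SameResidue adjZ {s} (ψ C) (ψ D))
    (hψ' : ∀ s C D, GraphProduct.sEquiv q s C D → SameResidue adjZ {s} (ψ' C) (ψ' D))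
    {C₁ : GraphProduct q} (h₁ : ψ C₁ = ψ' C₁) : ψ = ψ' := by
  funext C
  have h := sameResidue_univ hadj hq C₁ C
  induction h with
  | refl => exact h₁
  | @tail D E _ h ih =>
    obtain ⟨s, -, h⟩ := h
    have h1 := hψ s D E h
    have h2 := hψ' s D E h
    rw [ih] at h1
    exact hZ.inj (sphericalSingle _ s) _ _ ((h1.symm hZ.symm).trans h2) (hb E)

end GraphProduct

end GraphBuilding

/-! ### Spherical subsets of graph products of Coxeter groups -/

namespace GraphBuilding

section

variable {I : Type*} {Γ : SimpleGraph I} {S : I → Type*} {M : ∀ i, CoxeterMatrix (S i)}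

theorem gpMatrix_same (i : I) (s t : S i) : gpMatrix Γ M ⟨i, s⟩ ⟨i, t⟩ = M i s t := by
  change Matrix.of _ _ _ = _
  simp

theorem gpMatrix_adj {i j : I} (h : Γ.Adj i j) (s : S i) (t : S j) :
    gpMatrix Γ M ⟨i, s⟩ ⟨j, t⟩ = 2 := by
  change Matrix.of _ _ _ = _
  simp [h.ne, h]

theorem gpMatrix_not_adj {i j : I} (hij : i ≠ j) (h : ¬ Γ.Adj i j) (s : S i) (t : S j) :
    gpMatrix Γ M ⟨i, s⟩ ⟨j, t⟩ = 0 := by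
  change Matrix.of _ _ _ = _
  simp [hij, h]

/-- A homomorphism from the graph product that sends all generators of a factor to the same
involution. -/
theorem exists_hom_gp {G : Type*} [Group G] (f : I → G) (hf : ∀ i, f i * f i = 1)
    (hcomm : ∀ i j, Γ.Adj i j → f i * f j = f j * f i) :
    ∃ F : (gpMatrix Γ M).Group →* G, ∀ s, F ((gpMatrix Γ M).simple s) = f s.1 := by
  have h : (gpMatrix Γ M).IsLiftable fun s => f s.1 := by
    rintro ⟨i, s⟩ ⟨j, t⟩
    by_cases hij : i = j
    · subst hij
      simp [hf]
    · by_cases ha : Γ.Adj i j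
      · rw [gpMatrix_adj ha, pow_two]
        calc f i * f j * (f i * f j) = f i * f j * (f j * f i) := by rw [hcomm i j ha]
          _ = f i * (f j * f j) * f i := by simp only [mul_assoc]
          _ = 1 := by rw [hf, mul_one, hf]
      · rw [gpMatrix_not_adj hij ha, pow_zero]
  exact ⟨(gpMatrix Γ M).toCoxeterSystem.lift ⟨_, h⟩, fun s =>
    (gpMatrix Γ M).toCoxeterSystem.lift_apply_simple h s⟩

/-- The factors that meet a spherical subset are pairwise adjacent. -/
theorem adj_of_spherical (T : SphericalPoset (gpMatrix Γ M)) {s t : Σ i, S i} (hs : s ∈ T.1)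
    (ht : t ∈ T.1) (hst : s.1 ≠ t.1) : Γ.Adj s.1 t.1 := by
  classical
  by_contra ha
  -- `DihedralGroup 0` is infinite dihedral. Sending two non-adjacent factors to distinct
  -- reflections, and the others to `1`, gives `st` the image `r 1` of infinite order.
  obtain ⟨F, hF⟩ := exists_hom_gp (Γ := Γ) (M := M) (G := DihedralGroup 0)
    (fun k => if k = s.1 then .sr 0 else if k = t.1 then .sr 1 else 1)
    (fun k => by
      split_ifs
      · rw [DihedralGroup.sr_mul_sr, sub_self]; rfl
      · rw [DihedralGroup.sr_mul_sr, sub_self]; rfl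
      · rw [mul_one])
    (fun i j hij => by
      by_cases h1 : i = s.1 <;> by_cases h2 : j = s.1 <;> by_cases h3 : i = t.1 <;>
        by_cases h4 : j = t.1 <;> simp_all [Γ.adj_comm])
  let g : (gpMatrix Γ M).Group := (gpMatrix Γ M).simple s * (gpMatrix Γ M).simple t
  have hg : g ∈ Subgroup.closure ((gpMatrix Γ M).simple '' T.1) :=
    mul_mem (Subgroup.subset_closure ⟨s, hs, rfl⟩) (Subgroup.subset_closure ⟨t, ht, rfl⟩)
  have hfin : IsOfFinOrder g := by
    rw [← finite_zpowers]
    exact T.2.subset ((Subgroup.zpowers_le (g := g)).2 hg)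
  have h1 : F g = DihedralGroup.r 1 := by
    simp [g, hF, hst.symm]
  have h2 := h1 ▸ F.isOfFinOrder hfin
  rw [← orderOf_pos_iff, DihedralGroup.orderOf_r_one] at h2
  exact lt_irrefl _ h2

/-- The elements `simple s` with `s ∈ T` are finitely many, and the sign character that is `-1`
exactly on the generators of the factor `i` reads the factor off the element. -/
theorem finite_fst_image (T : SphericalPoset (gpMatrix Γ M)) :
    (Sigma.fst '' T.1 : Set I).Finite := by
  classical
  have h : ∀ i, ∃ F : (gpMatrix Γ M).Group →* ℤˣ,
      ∀ s, F ((gpMatrix Γ M).simple s) = if s.1 = i then -1 else 1 := fun i =>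
    exists_hom_gp (fun k => if k = i then -1 else 1) (fun k => by split_ifs <;> simp)
      fun _ _ _ => mul_comm _ _
  choose F hF using h
  have hfin : ((gpMatrix Γ M).simple '' T.1).Finite := T.2.subset Subgroup.subset_closure
  have hsub : (Sigma.fst '' T.1 : Set I) ⊆
      ⋃ g ∈ (gpMatrix Γ M).simple '' T.1, {i | F i g = -1} := by
    rintro _ ⟨s, hs, rfl⟩
    simp only [Set.mem_iUnion]
    exact ⟨_, ⟨s, hs, rfl⟩, by simp [hF]⟩
  refine (hfin.biUnion ?_).subset hsub
  rintro _ ⟨s, hs, rfl⟩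
  refine (Set.finite_singleton s.1).subset fun i hi => ?_
  have hi : F i ((gpMatrix Γ M).simple s) = -1 := hi
  rw [hF] at hi
  by_contra hne
  rw [if_neg (fun h => hne h.symm)] at hi
  exact absurd hi (by decide)

-- A finitely generated abelian group of exponent two is finite.
open scoped IsMulCommutative in
theorem finite_closure_of_commute {G : Type*} [Group G] {A : Set G} (hA : A.Finite)
    (hcomm : ∀ x ∈ A, ∀ y ∈ A, x * y = y * x) (hsq : ∀ x ∈ A, x * x = 1) :
    (Subgroup.closure A : Set G).Finite := by
  have := Subgroup.isMulCommutative_closure hcomm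
  have : Group.FG (Subgroup.closure A) := by
    rw [Group.fg_iff_subgroup_fg]
    exact ⟨hA.toFinset, by simp⟩
  have ht : IsMulTorsion (Subgroup.closure A) := by
    rintro ⟨x, hx⟩
    refine isOfFinOrder_iff_pow_eq_one.2 ⟨2, two_pos, ?_⟩
    have key : ∀ y : Subgroup.closure A, y * y = 1 := by
      rintro ⟨y, hy⟩
      induction hy using Subgroup.closure_induction with
      | mem y hy => exact Subtype.ext (hsq y hy)
      | one => exact mul_one _
      | mul a b ha hb iha ihb =>
        have : (⟨a * b, mul_mem ha hb⟩ : Subgroup.closure A) = ⟨a, ha⟩ * ⟨b, hb⟩ := rfl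
        rw [this, mul_mul_mul_comm, iha, ihb, one_mul]
      | inv a ha iha =>
        have : (⟨a⁻¹, inv_mem ha⟩ : Subgroup.closure A) = (⟨a, ha⟩)⁻¹ := rfl
        rw [this, ← mul_inv, iha, inv_one]
    rw [pow_two, key]
  have : Finite (Subgroup.closure A) := CommGroup.finite_of_fg_isMulTorsion _ ht
  exact Set.toFinite _

/-- The types of the factors that meet a spherical subset form a spherical subset of the graph
product of groups of order two. -/
def sphericalFactors (T : SphericalPoset (gpMatrix Γ M)) :
    SphericalPoset (gpMatrix Γ fun _ : I => rankOneMatrix) :=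
  ⟨(fun i => ⟨i, ()⟩) '' (Sigma.fst '' T.1), by
    refine finite_closure_of_commute (((finite_fst_image T).image _).image _) ?_ ?_
    · rintro _ ⟨_, ⟨i, ⟨s, hs, rfl⟩, rfl⟩, rfl⟩ _ ⟨_, ⟨j, ⟨t, ht, rfl⟩, rfl⟩, rfl⟩
      by_cases h : s.1 = t.1
      · rw [h]
      · have h1 := (gpMatrix Γ fun _ : I => rankOneMatrix).toCoxeterSystem.simple_mul_simple_pow
          ⟨s.1, ()⟩ ⟨t.1, ()⟩
        rw [gpMatrix_adj (adj_of_spherical T hs ht h), pow_two, mul_eq_one_iff_eq_inv, mul_inv_rev,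
          CoxeterSystem.inv_simple, CoxeterSystem.inv_simple] at h1
        exact h1
    · rintro _ ⟨_, ⟨i, -, rfl⟩, rfl⟩
      exact simple_mul_self _ _⟩

end

/-! ### Products of buildings -/

section

variable {I : Type*} {S W B : I → Type*} [∀ i, Group (W i)]
  {M : ∀ i, CoxeterMatrix (S i)} {cs : ∀ i, CoxeterSystem (M i) (W i)} {δ : ∀ i, B i → B i → W i}

theorem prodAdj_iff (h1 : ∀ i C D, δ i C D = 1 ↔ C = D) {i : I} {s : S i} {C D : ∀ i, B i} :
    prodAdj cs δ ⟨i, s⟩ C D ↔ δ i (C i) (D i) = (cs i).simple s ∧ ∀ j ≠ i, C j = D j := by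
  classical
  rw [prodAdj, funext_iff]
  constructor
  · intro h
    refine ⟨by simpa using h i, fun j hj => (h1 j _ _).1 ?_⟩
    simpa [hj] using h j
  · rintro ⟨h, h'⟩ j
    by_cases hj : j = i
    · subst hj; simpa using h
    · simpa [hj, h1] using h' j hj

theorem prodAdj_or_eq_iff (h1 : ∀ i C D, δ i C D = 1 ↔ C = D) {i : I} {s : S i}
    {C D : ∀ i, B i} : (prodAdj cs δ ⟨i, s⟩ C D ∨ C = D) ↔
      sEquiv (cs i) (δ i) s (C i) (D i) ∧ ∀ j ≠ i, C j = D j := by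
  rw [prodAdj_iff h1]
  constructor
  · rintro (⟨h, h'⟩ | rfl)
    exacts [⟨Or.inl h, h'⟩, ⟨Or.inr rfl, fun _ _ => rfl⟩]
  · rintro ⟨h | h, h'⟩
    · exact Or.inl ⟨h, h'⟩
    · refine Or.inr (funext fun j => ?_)
      by_cases hj : j = i
      · subst hj; exact h
      · exact h' j hj

theorem isChamberSystem_prodAdj (h1 : ∀ i C D, δ i C D = 1 ↔ C = D)
    (h2 : ∀ i s, Equivalence (sEquiv (cs i) (δ i) s)) : IsChamberSystem (prodAdj cs δ) where
  symm := by
    rintro ⟨i, s⟩ C D h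
    rw [prodAdj_iff h1] at h ⊢
    refine ⟨?_, fun j hj => (h.2 j hj).symm⟩
    rcases (h2 i s).symm (Or.inl h.1) with h' | h'
    · exact h'
    · rw [← h.1, h']
  trans := by
    rintro ⟨i, s⟩ C D E h h'
    rw [prodAdj_iff h1] at h h'
    rw [prodAdj_or_eq_iff h1]
    exact ⟨(h2 i s).trans (Or.inl h.1) (Or.inl h'.1), fun j hj => (h.2 j hj).trans (h'.2 j hj)⟩

theorem sameResidue_prodAdj_iff (h1 : ∀ i C D, δ i C D = 1 ↔ C = D)
    (h2 : ∀ i s, Equivalence (sEquiv (cs i) (δ i) s)) {i : I} {s : S i} {C D : ∀ i, B i} :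
    SameResidue (prodAdj cs δ) {⟨i, s⟩} C D ↔
      sEquiv (cs i) (δ i) s (C i) (D i) ∧ ∀ j ≠ i, C j = D j := by
  rw [← prodAdj_or_eq_iff h1]
  refine ⟨(isChamberSystem_prodAdj h1 h2).panel, ?_⟩
  rintro (h | rfl)
  exacts [.single (Set.mem_singleton _) h, .refl _]

theorem rankOneDist_eq_one_iff {X : Type*} (C D : X) : rankOneDist X C D = 1 ↔ C = D := by
  unfold rankOneDist
  split_ifs with h
  · simp [h]
  · simp [h, simple_ne_one]

theorem sEquiv_rankOneDist {X : Type*} (s : Unit) (C D : X) :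
    sEquiv rankOneSystem (rankOneDist X) s C D := by
  by_cases h : C = D
  · exact Or.inr h
  · exact Or.inl (by simp [rankOneDist, h])

theorem sEquiv_rankOneDist_equivalence {X : Type*} (s : Unit) :
    Equivalence (sEquiv rankOneSystem (rankOneDist X) s) :=
  ⟨fun _ => sEquiv_rankOneDist _ _ _, fun _ => sEquiv_rankOneDist _ _ _,
    fun _ _ => sEquiv_rankOneDist _ _ _⟩

end

/-! ### Commuting families of relations -/

/-- Galleries whose types form a clique are determined by the projections of their end points. -/
theorem eq_of_sameResidue_clique {I Z : Type*} {Γ : SimpleGraph I} {B : I → Type*}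
    {R : I → Z → Z → Prop} {π : Z → ∀ i, B i} (hR : ∀ i z, R i z z)
    (htrans : ∀ i x y z, R i x y → R i y z → R i x z)
    (hπ : ∀ i z z', R i z z' → ∀ j ≠ i, π z j = π z' j)
    (hinj : ∀ i z z', R i z z' → π z i = π z' i → z = z')
    (hcomm : ∀ i j, Γ.Adj i j → ∀ x y z, R i x y → R j y z → ∃ y', R j x y' ∧ R i y' z)
    (J : Finset I) (hJ : ∀ i ∈ J, ∀ j ∈ J, i ≠ j → Γ.Adj i j) {z z' : Z}
    (h : SameResidue R (J : Set I) z z') (e : ∀ i ∈ J, π z i = π z' i) : z = z' := by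
  classical
  induction J using Finset.induction_on generalizing z z' with
  | empty =>
    induction h with
    | refl => rfl
    | tail _ h _ => obtain ⟨i, hi, -⟩ := h; simp at hi
  | insert j J hj ih =>
    -- Commutation moves all `j`-steps to the end, where they merge into one. The other steps fix
    -- the coordinate `j`, so this last step fixes it too and is trivial.
    have key : ∃ y, SameResidue R (J : Set I) z y ∧ R j y z' := by
      clear e
      induction h with
      | refl => exact ⟨z, .refl z, hR j z⟩
      | tail _ h ihg =>
        obtain ⟨y, hy, hjy⟩ := ihg
        obtain ⟨k, hk, h⟩ := h
        rw [Finset.mem_coe, Finset.mem_insert] at hk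
        rcases hk with rfl | hk
        · exact ⟨y, hy, htrans _ _ _ _ hjy h⟩
        · have hne : j ≠ k := by rintro rfl; exact hj hk
          obtain ⟨y', h1, h2⟩ := hcomm j k (hJ j (by simp) k (by simp [hk]) hne) _ _ _ hjy h
          exact ⟨y', hy.trans (.single (by simpa using hk) h1), h2⟩
    obtain ⟨y, hy, hjy⟩ := key
    have hoff : ∀ x, SameResidue R (J : Set I) z x → π z j = π x j := by
      intro x hx
      induction hx with
      | refl => rfl
      | tail _ h ihg =>
        obtain ⟨k, hk, h⟩ := h
        exact ihg.trans (hπ k _ _ h j (by rintro rfl; exact hj (by simpa using hk)))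
    have h1 : y = z' := hinj j y z' hjy ((hoff y hy).symm.trans (e j (by simp)))
    subst h1
    exact ih (fun i hi k hk => hJ i (by simp [hi]) k (by simp [hk])) hy
      fun i hi => e i (by simp [hi])

end GraphBuilding

/-! ### Residues of the factors in a graph product -/

namespace GraphBuilding

namespace GraphProduct

variable {I : Type*} {Γ : SimpleGraph I} {S W B : I → Type*} [∀ i, Group (W i)]
  {M : ∀ i, CoxeterMatrix (S i)} {cs : ∀ i, CoxeterSystem (M i) (W i)} {δ : ∀ i, B i → B i → W i}
  {YE Y : Type*} [TopologicalSpace YE] [TopologicalSpace Y]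
  {qE : YE → RankOneGPRealization Γ B} {q : Y → GPRealization Γ cs δ}

theorem SameResidueAt.symm {i : I} {C D : GraphProduct q} (h : SameResidueAt q i C D) :
    SameResidueAt q i D C :=
  SameResidue.symm sEquiv_symm h

theorem SameResidueAt.single {i : I} {s : S i} {C D : GraphProduct q}
    (h : GraphProduct.sEquiv q ⟨i, s⟩ C D) : SameResidueAt q i C D :=
  SameResidue.single (T := {s : Σ i, S i | s.1 = i}) (by exact rfl) h

theorem isChamberSystem_rankOne (B : I → Type*) :
    IsChamberSystem (prodAdj (fun _ : I => rankOneSystem) fun i => rankOneDist (B i)) :=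
  isChamberSystem_prodAdj (fun _ => rankOneDist_eq_one_iff)
    fun _ => sEquiv_rankOneDist_equivalence

theorem isChamberSystem_of_isBuilding (hB : ∀ i, IsBuilding (cs i) (δ i)) :
    IsChamberSystem (prodAdj cs δ) :=
  isChamberSystem_prodAdj (fun i => (hB i).wd1) fun i => (hB i).sEquiv_equivalence

theorem base_eq_of_rankOne_sEquiv {t : Σ _ : I, Unit} {C D : GraphProduct qE}
    (h : GraphProduct.sEquiv qE t C D) : ∀ j ≠ t.1, C.base j = D.base j :=
  ((sameResidue_prodAdj_iff (fun _ => rankOneDist_eq_one_iff)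
    fun _ => sEquiv_rankOneDist_equivalence).1
      (base_of_sEquiv (isChamberSystem_rankOne B) h)).2

/-- A panel of the right-angled building contains a chamber over each chamber of a factor. -/
theorem exists_rankOne_sEquiv (hqE : IsCoveringMap qE) (i : I) (C : GraphProduct qE)
    {b : ∀ i, B i} (hb : ∀ j ≠ i, C.base j = b j) :
    ∃ D : GraphProduct qE, D.base = b ∧ GraphProduct.sEquiv qE ⟨i, ()⟩ C D := by
  have hE := isChamberCover (isChamberSystem_rankOne B) hqE
  rcases (prodAdj_or_eq_iff (cs := fun _ : I => rankOneSystem) (δ := fun i => rankOneDist (B i))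
    (i := i) (s := ()) (fun _ => rankOneDist_eq_one_iff)).2
    ⟨sEquiv_rankOneDist () (C.base i) (b i), hb⟩ with h | h
  · exact hE.lift ⟨i, ()⟩ C b h
  · exact ⟨C, h, fun _ _ => rfl⟩

variable (hB : ∀ i, IsBuilding (cs i) (δ i))
include hB

theorem base_of_sEquiv' {i : I} {s : S i} {C D : GraphProduct q}
    (h : GraphProduct.sEquiv q ⟨i, s⟩ C D) :
    GraphBuilding.sEquiv (cs i) (δ i) s (C.base i) (D.base i) ∧ ∀ j ≠ i, C.base j = D.base j :=
  (sameResidue_prodAdj_iff (fun i => (hB i).wd1) fun i => (hB i).sEquiv_equivalence).1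
    (base_of_sEquiv (isChamberSystem_of_isBuilding hB) h)

theorem SameResidueAt.base_eq {i : I} {C D : GraphProduct q} (h : SameResidueAt q i C D) :
    ∀ j ≠ i, C.base j = D.base j := by
  induction h with
  | refl => exact fun _ _ => rfl
  | tail _ h ih =>
    obtain ⟨⟨i', s⟩, rfl, h⟩ := h
    exact fun j hj => (ih j hj).trans ((base_of_sEquiv' hB h).2 j hj)

theorem exists_sEquiv (hq : IsCoveringMap q) {i : I} (s : S i) (C : GraphProduct q)
    {b : ∀ i, B i} (h : GraphBuilding.sEquiv (cs i) (δ i) s (C.base i) (b i))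
    (h' : ∀ j ≠ i, C.base j = b j) :
    ∃ D : GraphProduct q, D.base = b ∧ GraphProduct.sEquiv q ⟨i, s⟩ C D := by
  rcases (prodAdj_or_eq_iff fun i => (hB i).wd1).2 ⟨h, h'⟩ with h | h
  · exact (isChamberCover (isChamberSystem_of_isBuilding hB) hq).lift ⟨i, s⟩ C b h
  · exact ⟨C, h, fun _ _ => rfl⟩

/-- The residues of type `S i` of the graph product cover the factor `B i`. -/
theorem isBuildingCover (hq : IsCoveringMap q) (i : I) :
    IsBuildingCover (cs i) (δ i) (fun s => GraphProduct.sEquiv q ⟨i, s⟩)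
      (fun C : GraphProduct q => C.base i) where
  symm _ := sEquiv_symm _
  map _ _ _ h := (base_of_sEquiv' hB h).1
  lift s C b h := by
    classical
    obtain ⟨D, hD, h'⟩ := exists_sEquiv hB hq s C (b := Function.update C.base i b) (by simpa)
      fun j hj => by simp [hj]
    exact ⟨D, by simp [hD], h'⟩
  inj s t C D hk h e := by
    obtain ⟨k, hk, hst⟩ := hk
    -- The homomorphism from `W i` to the graph product carries the finite order of `st` over, so
    -- that `{s, t}` is spherical there.
    have hl : (M i).IsLiftable fun s => (gpMatrix Γ M).simple ⟨i, s⟩ := fun s t => by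
      rw [← gpMatrix_same (Γ := Γ)]
      exact (gpMatrix Γ M).toCoxeterSystem.simple_mul_simple_pow ⟨i, s⟩ ⟨i, t⟩
    have hst' := congrArg ((cs i).lift ⟨_, hl⟩) hst
    rw [map_pow, map_mul, map_one, (cs i).lift_apply_simple, (cs i).lift_apply_simple] at hst'
    have hr : SameResidue (GraphProduct.sEquiv q) {⟨i, s⟩, ⟨i, t⟩} C D :=
      h.map id fun r hr _ _ h => .single (s := ⟨i, r⟩) (by
        rcases hr with rfl | hr
        · simp
        · rw [Set.mem_singleton_iff] at hr
          simp [hr]) h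
    refine (isChamberCover (isChamberSystem_of_isBuilding hB) hq).inj
      (sphericalPair (gpMatrix Γ M) hk hst') C D hr (funext fun j => ?_)
    by_cases hj : j = i
    · subst hj; exact e
    · refine SameResidueAt.base_eq hB (i := i) (hr.mono ?_) j hj
      rintro _ (rfl | rfl) <;> rfl

/-- Here simple connectedness of `B i` enters. Together with `exists_sameResidueAt` it identifies
every `S i`-residue with `B i`. -/
theorem SameResidueAt.eq (hq : IsCoveringMap q) {i : I} {C D : GraphProduct q}
    (h : SameResidueAt q i C D) (e : C.base i = D.base i) : C = D := by
  refine (isBuildingCover hB hq i).injective (hB i) (h.map id ?_) e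
  rintro ⟨i', s⟩ rfl C D h
  exact .single (Set.mem_univ s) h

theorem exists_sameResidueAt (hq : IsCoveringMap q) (i : I) (C : GraphProduct q) {b : ∀ i, B i}
    (hb : ∀ j ≠ i, C.base j = b j) :
    ∃ D : GraphProduct q, D.base = b ∧ SameResidueAt q i C D := by
  have key : ∀ c, SameResidue (GraphBuilding.sEquiv (cs i) (δ i)) Set.univ (C.base i) c →
      ∃ D : GraphProduct q, D.base i = c ∧ SameResidueAt q i C D := by
    intro c hc
    induction hc with
    | refl => exact ⟨C, rfl, .refl C⟩
    | tail _ h ih =>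
      obtain ⟨D, rfl, hD⟩ := ih
      obtain ⟨s, -, h⟩ := h
      obtain ⟨E, hE, hDE⟩ := (isBuildingCover hB hq i).lift s D _ h
      exact ⟨E, hE, hD.trans (SameResidueAt.single hDE)⟩
  obtain ⟨D, hD, hCD⟩ := key (b i) ((hB i).sameResidue_univ _ _)
  refine ⟨D, funext fun j => ?_, hCD⟩
  by_cases hj : j = i
  · subst hj; exact hD
  · exact (SameResidueAt.base_eq hB hCD j hj).symm.trans (hb j hj)

theorem sEquiv_iff (hq : IsCoveringMap q) {i : I} {s : S i} {C D : GraphProduct q} :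
    GraphProduct.sEquiv q ⟨i, s⟩ C D ↔ SameResidueAt q i C D ∧
      GraphBuilding.sEquiv (cs i) (δ i) s (C.base i) (D.base i) := by
  constructor
  · exact fun h => ⟨SameResidueAt.single h, (base_of_sEquiv' hB h).1⟩
  · rintro ⟨h, h'⟩
    obtain ⟨D', hD', hs⟩ := exists_sEquiv hB hq s C h' (SameResidueAt.base_eq hB h)
    have h1 : SameResidueAt q i D' D :=
      (SameResidueAt.symm (SameResidueAt.single hs)).trans h
    rwa [← SameResidueAt.eq hB hq h1 (by rw [hD'])]

/-- Steps in different factors commute in the product. For adjacent factors `{s, t}` is spherical,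
so the lifted square closes up. -/
theorem exists_sEquiv_comm (hq : IsCoveringMap q) {i j : I} (hij : Γ.Adj i j) {s : S i} {t : S j}
    {C D E : GraphProduct q} (h : GraphProduct.sEquiv q ⟨i, s⟩ C D)
    (h' : GraphProduct.sEquiv q ⟨j, t⟩ D E) :
    ∃ D', GraphProduct.sEquiv q ⟨j, t⟩ C D' ∧ GraphProduct.sEquiv q ⟨i, s⟩ D' E := by
  classical
  have hb := base_of_sEquiv' hB h
  have hb' := base_of_sEquiv' hB h'
  obtain ⟨D', h1, h2⟩ := exists_sEquiv hB hq t C (b := Function.update C.base j (E.base j))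
    (by rw [hb.2 j hij.ne']; simpa using hb'.1) fun k hk => by simp [hk]
  obtain ⟨E', h3, h4⟩ := exists_sEquiv hB hq s D' (b := E.base)
    (by rw [h1, Function.update_of_ne hij.ne, ← hb'.2 i hij.ne]; exact hb.1) fun k hk => by
      rw [h1]
      by_cases hkj : k = j
      · subst hkj; simp
      · rw [Function.update_of_ne hkj, hb.2 k hk, hb'.2 k hkj]
  refine ⟨D', h2, ?_⟩
  have hpow : ((gpMatrix Γ M).simple ⟨i, s⟩ * (gpMatrix Γ M).simple ⟨j, t⟩) ^ 2 = 1 := by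
    rw [← gpMatrix_adj (M := M) hij s t]
    exact (gpMatrix Γ M).toCoxeterSystem.simple_mul_simple_pow ⟨i, s⟩ ⟨j, t⟩
  have hi : (⟨i, s⟩ : Σ i, S i) ∈ ({⟨i, s⟩, ⟨j, t⟩} : Set (Σ i, S i)) := by simp
  have hj : (⟨j, t⟩ : Σ i, S i) ∈ ({⟨i, s⟩, ⟨j, t⟩} : Set (Σ i, S i)) := by simp
  have hr : SameResidue (GraphProduct.sEquiv q) {⟨i, s⟩, ⟨j, t⟩} E E' :=
    (SameResidue.single hj (sEquiv_symm _ _ _ h')).trans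
      ((SameResidue.single hi (sEquiv_symm _ _ _ h)).trans
        ((SameResidue.single hj h2).trans (.single hi h4)))
  rwa [(isChamberCover (isChamberSystem_of_isBuilding hB) hq).inj
    (sphericalPair (gpMatrix Γ M) two_ne_zero hpow) E E' hr h3.symm]

theorem exists_sameResidueAt_comm (hq : IsCoveringMap q) {i j : I} (hij : Γ.Adj i j)
    {C D E : GraphProduct q} (h : SameResidueAt q i C D) (h' : SameResidueAt q j D E) :
    ∃ D', SameResidueAt q j C D' ∧ SameResidueAt q i D' E := by
  have key : ∀ (s : S i) {C D E : GraphProduct q}, GraphProduct.sEquiv q ⟨i, s⟩ C D →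
      SameResidueAt q j D E →
      ∃ D', SameResidueAt q j C D' ∧ GraphProduct.sEquiv q ⟨i, s⟩ D' E := by
    intro s C D E h h'
    induction h' with
    | refl => exact ⟨C, .refl C, h⟩
    | tail _ h1 ih =>
      obtain ⟨D', h2, h3⟩ := ih
      obtain ⟨⟨j', t⟩, rfl, h1⟩ := h1
      obtain ⟨E', h4, h5⟩ := exists_sEquiv_comm hB hq hij h3 h1
      exact ⟨E', h2.trans (SameResidueAt.single h4), h5⟩
  induction h using Relation.ReflTransGen.head_induction_on with
  | refl => exact ⟨E, h', .refl E⟩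
  | head h1 _ ih =>
    obtain ⟨D', h2, h3⟩ := ih
    obtain ⟨⟨i', s⟩, rfl, h1⟩ := h1
    obtain ⟨E', h4, h5⟩ := key s h1 h2
    exact ⟨E', h4, SameResidue.trans (SameResidueAt.single h5) h3⟩

/-- The graph product, with the residues of type `S i` as `i`-panels, covers the product of the
rank-one buildings. -/
theorem isChamberCover_residues (hq : IsCoveringMap q) :
    IsChamberCover (gpMatrix Γ fun _ : I => rankOneMatrix)
      (prodAdj (fun _ : I => rankOneSystem) fun i => rankOneDist (B i))
      (fun t => SameResidueAt q t.1) GraphProduct.base where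
  symm _ _ _ h := SameResidueAt.symm h
  map t C D h := (sameResidue_prodAdj_iff (fun _ => rankOneDist_eq_one_iff)
    fun _ => sEquiv_rankOneDist_equivalence).2
      ⟨sEquiv_rankOneDist _ _ _, SameResidueAt.base_eq hB h⟩
  lift t C b h := exists_sameResidueAt hB hq t.1 C
    ((prodAdj_iff (fun _ => rankOneDist_eq_one_iff)).1 h).2
  inj T C D h e := by
    refine eq_of_sameResidue_clique (Γ := Γ) (R := fun i => SameResidueAt q i)
      (π := GraphProduct.base) (fun _ => .refl) (fun _ _ _ _ => .trans)
      (fun _ _ _ h => SameResidueAt.base_eq hB h) (fun _ _ _ => SameResidueAt.eq hB hq)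
      (fun i j hij x y z h h' => exists_sameResidueAt_comm hB hq hij h h')
      (finite_fst_image T).toFinset ?_ (h.map id fun t ht _ _ h => .single (s := t.1) ?_ h)
      fun i _ => congrFun e i
    · intro i hi j hj hij
      rw [Set.Finite.mem_toFinset] at hi hj
      obtain ⟨s, hs, rfl⟩ := hi
      obtain ⟨t, ht, rfl⟩ := hj
      exact adj_of_spherical T hs ht hij
    · rw [Set.Finite.coe_toFinset]
      exact ⟨t, ht, rfl⟩

/-- The right-angled building, with its panels refined by the panels of the factors, covers the
product of the buildings. -/
theorem isChamberCover_refined (hqE : IsCoveringMap qE) :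
    IsChamberCover (gpMatrix Γ M) (prodAdj cs δ)
      (fun s C D => GraphProduct.sEquiv qE ⟨s.1, ()⟩ C D ∧
        GraphBuilding.sEquiv (cs s.1) (δ s.1) s.2 (C.base s.1) (D.base s.1))
      (GraphProduct.base (q := qE)) where
  symm s C D h := ⟨sEquiv_symm _ _ _ h.1, ((hB s.1).sEquiv_equivalence s.2).symm h.2⟩
  map s C D h := (sameResidue_prodAdj_iff (fun i => (hB i).wd1)
    fun i => (hB i).sEquiv_equivalence).2 ⟨h.2, base_eq_of_rankOne_sEquiv h.1⟩
  lift s C b h := by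
    rw [prodAdj_iff fun i => (hB i).wd1] at h
    obtain ⟨D, rfl, hD⟩ := exists_rankOne_sEquiv hqE s.1 C h.2
    exact ⟨D, rfl, hD, Or.inl h.1⟩
  inj T C D h e := by
    refine (isChamberCover (isChamberSystem_rankOne B) hqE).inj (sphericalFactors T) C D
      (h.map id fun s hs _ _ h => .single (s := ⟨s.1, ()⟩) ?_ h.1) e
    exact ⟨s.1, ⟨s, hs, rfl⟩, rfl⟩

end GraphProduct

/-! ### Identifications -/

section

variable {I : Type*} {Γ : SimpleGraph I} {S W B : I → Type*} [∀ i, Group (W i)]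
  {M : ∀ i, CoxeterMatrix (S i)} {cs : ∀ i, CoxeterSystem (M i) (W i)} {δ : ∀ i, B i → B i → W i}
  {YE Y : Type*} [TopologicalSpace YE] [TopologicalSpace Y]
  {qE : YE → RankOneGPRealization Γ B} {q : Y → GPRealization Γ cs δ}

open GraphProduct

/-- `χ` and `ψ` come from the two universal properties. Their composites respect panels and
projections and fix a base chamber, so they are identities. -/
theorem exists_isUnderlyingIso (hB : ∀ i, IsBuilding (cs i) (δ i)) (hqE : IsUniversalCovering qE)
    (hq : IsUniversalCovering q) (C₀ : GraphProduct qE) (C₁ : GraphProduct q)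
    (h : C₀.base = C₁.base) :
    ∃ φ : GraphProduct qE ≃ GraphProduct q, IsUnderlyingIso qE q φ ∧ φ C₀ = C₁ := by
  have hadjE := isChamberSystem_rankOne B
  have hadj := isChamberSystem_of_isBuilding hB
  have hcE := hqE.isCoveringMap
  have hc := hq.isCoveringMap
  obtain ⟨χ, hχb, hχ₀, hχ⟩ := exists_map hadjE hqE (isChamberCover_residues hB hc) C₀ C₁ h.symm
  obtain ⟨ψ, hψb, hψ₁, hψ⟩ := exists_map hadj hq (isChamberCover_refined hB hcE) C₁ C₀ h
  have hχ' : ∀ i C D, GraphProduct.sEquiv qE ⟨i, ()⟩ C D → SameResidueAt q i (χ C) (χ D) := by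
    exact fun i C D hCD => SameResidue.of_singleton
      (r := fun t : Σ _ : I, Unit => SameResidueAt q t.1) (s := ⟨i, ()⟩) (fun _ => .refl _)
      (fun _ _ _ => .trans) (hχ ⟨i, ()⟩ C D hCD)
  have hψ' : ∀ i C D, SameResidueAt q i C D → GraphProduct.sEquiv qE ⟨i, ()⟩ (ψ C) (ψ D) := by
    intro i C D hCD
    induction hCD with
    | refl => exact fun _ _ => rfl
    | tail _ h ih =>
      obtain ⟨s, rfl, h⟩ := h
      have h1 := SameResidue.of_singleton (fun _ => ⟨fun _ _ => rfl, Or.inr rfl⟩)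
        (fun _ _ _ h h' => ⟨fun x hx => (h.1 x hx).trans (h'.1 x hx),
          ((hB s.1).sEquiv_equivalence s.2).trans h.2 h'.2⟩) (hψ s _ _ h)
      exact fun x hx => (ih x hx).trans (h1.1 x hx)
  have hψχ : ψ ∘ χ = id := by
    refine map_ext hadjE hqE (isChamberCover hadjE hcE) (C₁ := C₀) (fun C => ?_)
      (fun t C D hCD => ?_) (fun t C D hCD => .single (Set.mem_singleton t) hCD) ?_
    · exact (hψb _).trans (hχb C)
    · exact .single (Set.mem_singleton t) (hψ' t.1 _ _ (hχ' t.1 _ _ hCD))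
    · exact (congrArg ψ hχ₀).trans hψ₁
  have hχψ : χ ∘ ψ = id := by
    refine map_ext hadj hq (isChamberCover hadj hc) (C₁ := C₁) (fun C => ?_)
      (fun s C D hCD => ?_) (fun s C D hCD => .single (Set.mem_singleton s) hCD) ?_
    · exact (hχb _).trans (hψb C)
    · refine .single (Set.mem_singleton s) ((sEquiv_iff hB hc).2 ⟨?_, ?_⟩)
      · exact hχ' s.1 _ _ (hψ' s.1 _ _ (SameResidueAt.single (s := s.2) hCD))
      · have e : ∀ E, (χ (ψ E)).base = E.base := fun E => (hχb _).trans (hψb E)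
        simp only [Function.comp_apply, e]
        exact (base_of_sEquiv' hB hCD).1
    · exact (congrArg χ hψ₁).trans hχ₀
  refine ⟨⟨χ, ψ, congrFun hψχ, congrFun hχψ⟩, ⟨hχb, fun i C D => ⟨hχ' i C D, fun hCD => ?_⟩⟩, hχ₀⟩
  have h1 := hψ' i _ _ hCD
  have e : ∀ E, ψ (χ E) = E := congrFun hψχ
  simpa only [Equiv.coe_fn_mk, e] using h1

theorem IsUnderlyingIso.unique (hB : ∀ i, IsBuilding (cs i) (δ i))
    (hqE : IsUniversalCovering qE) (hq : IsCoveringMap q) {φ φ' : GraphProduct qE ≃ GraphProduct q}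
    (h : IsUnderlyingIso qE q φ) (h' : IsUnderlyingIso qE q φ') {C₀ : GraphProduct qE}
    (e : φ C₀ = φ' C₀) : φ = φ' :=
  Equiv.coe_fn_injective (map_ext (isChamberSystem_rankOne B) hqE (isChamberCover_residues hB hq)
    (fun C => (h.proj C).trans (h'.proj C).symm)
    (fun t C D hCD => .single (Set.mem_singleton t) ((h.panel t.1 C D).1 hCD))
    (fun t C D hCD => .single (Set.mem_singleton t) ((h'.panel t.1 C D).1 hCD)) e)

theorem sameResidueAt_aut_iff {g : Equiv.Perm (GraphProduct q)} (hg : g ∈ GraphProduct.aut q)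
    (i : I) (C D : GraphProduct q) : SameResidueAt q i (g C) (g D) ↔ SameResidueAt q i C D := by
  have key : ∀ g ∈ GraphProduct.aut q, ∀ C D, SameResidueAt q i C D →
      SameResidueAt q i (g C) (g D) := fun g hg C D h =>
    SameResidue.map g (fun s hs C D h => .single hs ((hg s C D).2 h)) h
  refine ⟨fun h => ?_, key g hg C D⟩
  simpa using key g⁻¹ (inv_mem hg) _ _ h

/-- By `sEquiv_iff` there are two conditions to preserve: sharing an `S i`-residue, which `φ` turns
into sharing an `i`-panel, and `s`-equivalence of projections, on which `g` acts through an element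
of `Aut(B i)`. -/
theorem IsUnderlyingIso.conj_mem_aut (hB : ∀ i, IsBuilding (cs i) (δ i)) (hq : IsCoveringMap q)
    {φ : GraphProduct qE ≃ GraphProduct q} (hφ : IsUnderlyingIso qE q φ)
    {g : Equiv.Perm (GraphProduct qE)}
    (hg : g ∈ spAut qE (fun i => typeAut (sEquiv (cs i) (δ i)))) :
    φ.permCongr g ∈ GraphProduct.aut q := by
  rintro ⟨i, s⟩ C D
  obtain ⟨C, rfl⟩ := φ.surjective C
  obtain ⟨D, rfl⟩ := φ.surjective D
  rw [Equiv.permCongr_apply, Equiv.permCongr_apply, Equiv.symm_apply_apply,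
    Equiv.symm_apply_apply, sEquiv_iff hB hq, sEquiv_iff hB hq, ← hφ.panel, ← hφ.panel,
    hφ.proj, hφ.proj, hφ.proj, hφ.proj, hg.1 ⟨i, ()⟩ C D]
  refine and_congr_right fun h => ?_
  obtain ⟨a, ha⟩ := hg.2 i C
  rw [ha D h, ha C fun _ _ => rfl]
  exact a.2 s _ _

theorem IsUnderlyingIso.conj_symm_mem_spAut (hB : ∀ i, IsBuilding (cs i) (δ i))
    (hq : IsCoveringMap q)
    {φ : GraphProduct qE ≃ GraphProduct q} (hφ : IsUnderlyingIso qE q φ)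
    {g : Equiv.Perm (GraphProduct q)} (hg : g ∈ GraphProduct.aut q) :
    φ.symm.permCongr g ∈ spAut qE (fun i => typeAut (sEquiv (cs i) (δ i))) := by
  classical
  have happ : ∀ C, φ (φ.symm.permCongr g C) = g (φ C) := fun C => by
    simp [Equiv.permCongr_apply]
  refine ⟨fun t C D => ?_, fun i C => ?_⟩
  · rw [hφ.panel t.1, hφ.panel t.1, happ, happ, sameResidueAt_aut_iff hg]
  · -- the bijection of the factor induced on the residue of `C`
    have hex : ∀ (C : GraphProduct q) (b : B i), ∃ D, D.base i = b ∧ SameResidueAt q i C D :=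
      fun C b => by
        obtain ⟨D, hD, h⟩ := exists_sameResidueAt hB hq i C (b := Function.update C.base i b)
          fun j hj => by simp [hj]
        exact ⟨D, by simp [hD], h⟩
    -- `f C b` is the only chamber over `b` in the `S i`-residue of `C`. The permutation `a` lifts
    -- `b` to the residue of `φ C`, applies `g` and projects; its inverse does the same with `g⁻¹`
    -- from the residue of `g (φ C)`.
    choose f hf hfr using hex
    have hgi : ∀ D, g⁻¹ (g D) = D := g.symm_apply_apply
    have hig : ∀ D, g (g⁻¹ D) = D := g.apply_symm_apply
    have hfu : ∀ C D, SameResidueAt q i C D → f C (D.base i) = D := fun C D h =>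
      SameResidueAt.eq hB hq ((hfr C _).symm.trans h) (hf C _)
    let a : Equiv.Perm (B i) :=
      { toFun := fun b => (g (f (φ C) b)).base i
        invFun := fun b => (g⁻¹ (f (g (φ C)) b)).base i
        left_inv := fun b => by
          have h1 : SameResidueAt q i (g (φ C)) (g (f (φ C) b)) :=
            (sameResidueAt_aut_iff hg i _ _).2 (hfr (φ C) b)
          simp only
          rw [hfu _ _ h1, hgi, hf]
        right_inv := fun b => by
          have h1 : SameResidueAt q i (φ C) (g⁻¹ (f (g (φ C)) b)) := by
            have := (sameResidueAt_aut_iff (inv_mem hg) i _ _).2 (hfr (g (φ C)) b)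
            rwa [hgi] at this
          simp only
          rw [hfu _ _ h1, hig, hf] }
    have ha : a ∈ typeAut (sEquiv (cs i) (δ i)) := by
      intro s b b'
      have h1 : SameResidueAt q i (f (φ C) b) (f (φ C) b') := (hfr _ _).symm.trans (hfr _ _)
      have h2 := (sameResidueAt_aut_iff hg i _ _).2 h1
      have h3 := hg ⟨i, s⟩ (f (φ C) b) (f (φ C) b')
      rw [sEquiv_iff hB hq, sEquiv_iff hB hq, and_iff_right h1, and_iff_right h2, hf, hf] at h3
      exact h3
    refine ⟨⟨a, ha⟩, fun D hD => ?_⟩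
    rw [← hφ.proj, happ, ← hφ.proj]
    change _ = (g (f (φ C) ((φ D).base i))).base i
    rw [hfu _ _ ((hφ.panel i C D).1 hD)]

end

end GraphBuilding

theorem mainTheorem4 {I : Type*} (Γ : SimpleGraph I) {S W B : I → Type*} [∀ i, Group (W i)]
    {M : ∀ i, CoxeterMatrix (S i)} (cs : ∀ i, CoxeterSystem (M i) (W i))
    (δ : ∀ i, B i → B i → W i) (hB : ∀ i, IsBuilding (cs i) (δ i))
    {YE Y : Type*} [TopologicalSpace YE] [TopologicalSpace Y]
    (qE : YE → RankOneGPRealization Γ B) (hqE : IsUniversalCovering qE)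
    (q : Y → GPRealization Γ cs δ) (hq : IsUniversalCovering q) :
    (∃ φ : GraphProduct qE ≃ GraphProduct q, IsUnderlyingIso qE q φ) ∧
    (∀ (C₀ : GraphProduct qE) (C₁ : GraphProduct q), C₀.base = C₁.base →
      ∃! φ : GraphProduct qE ≃ GraphProduct q, IsUnderlyingIso qE q φ ∧ φ C₀ = C₁) ∧
    ∀ φ : GraphProduct qE ≃ GraphProduct q, IsUnderlyingIso qE q φ →
      ∃ Ψ : spAut qE (fun i => typeAut (sEquiv (cs i) (δ i))) ≃* GraphProduct.aut q,
        ∀ g C, (Ψ g : Equiv.Perm (GraphProduct q)) (φ C) =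
          φ ((g : Equiv.Perm (GraphProduct qE)) C) := by
  refine ⟨?_, fun C₀ C₁ h => ?_, fun φ hφ => ?_⟩
  -- Base chambers over a common `b` exist because both coverings are surjective.
  · have b : ∀ i, B i := fun i => (hB i).nonempty.some
    obtain ⟨y, hy⟩ := hq.surjective
      (Realization.mk _ _ b (PosetRealization.vertex (sphericalBot _)))
    obtain ⟨yE, hyE⟩ := hqE.surjective
      (Realization.mk _ _ b (PosetRealization.vertex (sphericalBot _)))
    obtain ⟨C₁, h₁, -⟩ := GraphProduct.exists_lift_eq hq.isCoveringMap hy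
    obtain ⟨C₀, h₀, -⟩ := GraphProduct.exists_lift_eq hqE.isCoveringMap hyE
    obtain ⟨φ, hφ, -⟩ := exists_isUnderlyingIso hB hqE hq C₀ C₁ (h₀.trans h₁.symm)
    exact ⟨φ, hφ⟩
  · obtain ⟨φ, hφ, e⟩ := exists_isUnderlyingIso hB hqE hq C₀ C₁ h
    exact ⟨φ, ⟨hφ, e⟩, fun φ' h' =>
      IsUnderlyingIso.unique hB hqE hq.isCoveringMap h'.1 hφ (h'.2.trans e.symm)⟩
  · refine ⟨{ toFun := fun g => ⟨φ.permCongr g, hφ.conj_mem_aut hB hq.isCoveringMap g.2⟩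
              invFun := fun g =>
                ⟨φ.symm.permCongr g, hφ.conj_symm_mem_spAut hB hq.isCoveringMap g.2⟩
              left_inv := fun g => Subtype.ext (Equiv.ext fun C => by simp [Equiv.permCongr_apply])
              right_inv := fun g => Subtype.ext (Equiv.ext fun C => by simp [Equiv.permCongr_apply])
              map_mul' := fun g h => Subtype.ext (Equiv.ext fun C => by simp [Equiv.permCongr_apply]) },
      fun g C => ?_⟩
    simp [Equiv.permCongr_apply]
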